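/- **Theorem (sublinear convergence of RRT\* in holonomic minimum-path-length planning).** Let $X\subset\mathbb R^n$ be a bounded measurable state space of positive Lebesgue measure, $X_{\rm obs}\subseteq X$ any set of obstacles, $X_{\rm free}=\mathrm{cl}(X\setminus X_{\rm obs})$, $x_{\rm start}\in X_{\rm free}$, and $X_{\rm goal}\subseteq X_{\rm free}$ measurable. The cost of a path is its Euclidean length; $c^*$ is the infimum of the lengths of paths in $X_{\rm free}$ from $x_{\rm start}$ to $X_{\rm goal}$, and for $x\in X_{\rm free}$, $f(x)$ is the infimal length of paths in $X_{\rm free}$ from $x_{\rm start}$ to $x$ plus that of paths from $x$ to $X_{\rm goal}$. Assume that either the set $\{x\in X_{\rm free}: f(x)=c^*\}$ of states on optimal solutions has Lebesgue measure $0$, or $n\ge 2$ and there is a single goal, $X_{\rm goal}=\{x_{\rm goal}\}$, and the segment $[x_{\rm start},x_{\rm goal}]$ is collision-free. Consider RRT\* with straight-line steering, any maximum edge length $\eta\in(0,\infty]$, and any rewiring neighbourhood (all vertices within distance $\min\{\eta,r(|V|)\}$ of the new state, for an arbitrary function $r$ of the number of vertices $|V|$ with values in $[0,\infty]$, or the $k(|V|)$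 nearest vertices, for an arbitrary function $k$). It is started from any finite collision-free tree rooted at $x_{\rm start}$ (for instance $x_{\rm start}$ alone), and the samples $x_0,x_1,\dots$ are independent and uniform on $X$. Let $c_i$ be the length of the best solution contained in the tree $T_i$ after $i$ iterations ($\infty$ if there is none), and let $G$ be the event that a solution is eventually found and $c_i>c^*$ for all $i$ (so that the error ratios below are eventually defined). Then the expected convergence rate is $1$, i.e. RRT\* converges sublinearly: 1. if $\mathbb P(G)>0$, then $\displaystyle\lim_{i\to\infty}\mathbb E\!\left[\frac{c_{i+1}-c^*}{c_i-c^*}\,\middle|\,G\right]=1$; 2. almost surely on $G$, $\displaystyle\lim_{i\to\infty}\frac{\mathbb E[c_{i+1}\mid x_0,\dots,x_{i-1}]-c^*}{c_i-c^*}=1$ (the expectation is over the next sample only); 3. almost surely on $G$, if the limit $\rho=\displaystyle\lim_{i\to\infty}\frac{c_{i+1}-c^*}{c_i-c^*}$ exists along the run, then $\rho=1$. -/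

import Mathlib

open MeasureTheory ProbabilityTheory Filter Topology
open scoped ENNReal

noncomputable section

namespace RRTStar

/-- The ambient space `ℝⁿ` with its Euclidean norm. -/
abbrev State (n : ℕ) : Type := EuclideanSpace ℝ (Fin n)

/-- A path-planning problem in `ℝⁿ`: a state space `X`, the states `X_obs ⊆ X` in collision with
obstacles, a start state and a set of goal states, both in the free space `cl (X \ X_obs)`. -/
structure Problem (n : ℕ) where
  /-- the state space -/
  stateSpace : Set (State n)
  /-- the states in collision -/
  obstacles : Set (State n)
  obstacles_subset : obstacles ⊆ stateSpace
  /-- the initial state -/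
  start : State n
  start_mem : start ∈ closure (stateSpace \ obstacles)
  /-- the desired states -/
  goal : Set (State n)
  goal_subset : goal ⊆ closure (stateSpace \ obstacles)

namespace Problem

variable {n : ℕ} (P : Problem n)

/-- The free space. -/
def free : Set (State n) := closure (P.stateSpace \ P.obstacles)

/-- Collision-free paths, parametrized by `[0, 1]`. -/
def IsPath (σ : ℝ → State n) : Prop :=
  ContinuousOn σ (Set.Icc 0 1) ∧ ∀ t ∈ Set.Icc (0 : ℝ) 1, σ t ∈ P.free

/-- The length of a path, possibly infinite. -/
def pathLength (σ : ℝ → State n) : ℝ≥0∞ := eVariationOn σ (Set.Icc 0 1)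

/-- The optimal cost-to-come of a state (infinite if the state cannot be reached). -/
def costToCome (x : State n) : ℝ≥0∞ :=
  ⨅ σ : ℝ → State n, ⨅ _ : P.IsPath σ ∧ σ 0 = P.start ∧ σ 1 = x, pathLength σ

/-- The optimal cost-to-go of a state. -/
def costToGo (x : State n) : ℝ≥0∞ :=
  ⨅ σ : ℝ → State n, ⨅ _ : P.IsPath σ ∧ σ 0 = x ∧ σ 1 ∈ P.goal, pathLength σ

/-- The optimal cost of a solution of the problem. -/
def optCost : ℝ≥0∞ :=
  ⨅ σ : ℝ → State n, ⨅ _ : P.IsPath σ ∧ σ 0 = P.start ∧ σ 1 ∈ P.goal, pathLength σ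

/-- The free states through which solutions of optimal cost pass. -/
def optimalStates : Set (State n) :=
  {x ∈ P.free | P.costToCome x + P.costToGo x = P.optCost}

/-- The straight connection of two states is collision-free. -/
def IsFree (v w : State n) : Prop := segment ℝ v w ⊆ P.free

/-- The uniform distribution on the state space. -/
def uniform : Measure (State n) := (volume : Measure (State n))[|P.stateSpace]

end Problem

/-- Holonomic steering from `v` towards `x` with maximum edge length `η` (possibly `∞`):
the point closest to `x` at distance at most `η` from `v`. -/
def steer {n : ℕ} (η : ℝ≥0∞) (v x : State n) : State n :=
  open Classical in
  if edist x v ≤ η then x else v + (η.toReal / ‖x - v‖) • (x - v)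

/-- `steer` solves the defining minimization problem, over `ℝⁿ` and over every convex
state space. -/
theorem steer_spec {n : ℕ} {η : ℝ≥0∞} {v x : State n} :
    (∀ X : Set (State n), Convex ℝ X → v ∈ X → x ∈ X → steer η v x ∈ X) ∧
      edist (steer η v x) v ≤ η ∧
      ∀ y, edist y v ≤ η → ‖x - steer η v x‖ ≤ ‖x - y‖ := by
  classical
  unfold steer
  split_ifs with h
  · exact ⟨fun X _ _ hx => hx, h, fun y _ => by simp⟩
  · push Not at h
    have htop : η ≠ ⊤ := ne_top_of_lt h
    have hlt : η.toReal < ‖x - v‖ := by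
      rw [← dist_eq_norm, ← ENNReal.ofReal_lt_ofReal_iff_of_nonneg ENNReal.toReal_nonneg,
        ENNReal.ofReal_toReal htop, ← edist_dist]
      exact h
    have hpos : 0 < ‖x - v‖ := lt_of_le_of_lt ENNReal.toReal_nonneg hlt
    have h0 : 0 ≤ η.toReal / ‖x - v‖ := div_nonneg ENNReal.toReal_nonneg hpos.le
    have h1 : η.toReal / ‖x - v‖ ≤ 1 := (div_le_one hpos).2 hlt.le
    refine ⟨fun X hX hv hx => hX.add_smul_sub_mem hv hx ⟨h0, h1⟩, ?_, fun y hy => ?_⟩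
    · rw [edist_dist, dist_eq_norm, add_sub_cancel_left, norm_smul, Real.norm_of_nonneg h0,
        div_mul_cancel₀ _ hpos.ne', ENNReal.ofReal_toReal htop]
    · have hy' : ‖y - v‖ ≤ η.toReal := by
        rw [← dist_eq_norm, ← ENNReal.ofReal_le_ofReal_iff ENNReal.toReal_nonneg,
          ENNReal.ofReal_toReal htop, ← edist_dist]
        exact hy
      have e : x - (v + (η.toReal / ‖x - v‖) • (x - v))
          = (1 - η.toReal / ‖x - v‖) • (x - v) := by
        rw [sub_smul, one_smul]; abel
      rw [e, norm_smul, Real.norm_of_nonneg (by linarith), sub_mul, one_mul,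
        div_mul_cancel₀ _ hpos.ne']
      have := norm_add_le (x - y) (y - v)
      rw [sub_add_sub_cancel] at this
      linarith

/-- The rewiring neighbourhood of a new state, as a function of the number of vertices: all
vertices within a given radius, or a given number of closest vertices. -/
inductive RewireRule where
  | radius (r : ℕ → ℝ≥0∞)
  | nearest (k : ℕ → ℕ)

/-- The tuning parameters: the maximum edge length and the rewiring neighbourhood. -/
structure Config where
  /-- the maximum edge length -/
  maxEdge : ℝ≥0∞
  /-- the rewiring rule -/
  rewire : RewireRule

/-- The data of a tree in `ℝⁿ`: the vertices are numbered `0, …, num - 1` in the order of their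
insertion, `0` is the root and is its own parent (values beyond `num` are irrelevant). -/
structure Tree (n : ℕ) where
  /-- the number of vertices -/
  num : ℕ
  /-- the positions of the vertices -/
  pos : ℕ → State n
  /-- the parents of the vertices -/
  parent : ℕ → ℕ

namespace Tree

variable {n : ℕ}

/-- A collision-free tree rooted at the start state. -/
structure IsValid (P : Problem n) (T : Tree n) : Prop where
  num_pos : 0 < T.num
  pos_root : T.pos 0 = P.start
  parent_root : T.parent 0 = 0
  parent_lt : ∀ j < T.num, T.parent j < T.num
  reaches_root : ∀ j < T.num, ∃ k, T.parent^[k] j = 0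
  pos_free : ∀ j < T.num, T.pos j ∈ P.free
  edge_free : ∀ j < T.num, P.IsFree (T.pos (T.parent j)) (T.pos j)

/-- The cost-to-come of a vertex through the tree: the length of the path to the root (which has
fewer than `num` edges; the remaining summands vanish). -/
def cost (T : Tree n) (j : ℕ) : ℝ :=
  ∑ k ∈ Finset.range T.num, ‖T.pos (T.parent^[k] j) - T.pos (T.parent^[k + 1] j)‖

/-- The cost of the best solution in the tree, `∞` if there is none. -/
def bestCost (P : Problem n) (T : Tree n) : ℝ≥0∞ :=
  ⨅ j : ℕ, ⨅ _ : j < T.num ∧ T.pos j ∈ P.goal, ENNReal.ofReal (T.cost j)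

open Classical in
/-- The (first) vertex nearest to a state. -/
def nearestVertex (T : Tree n) (x : State n) : ℕ :=
  (List.range T.num).foldl
    (fun b j => if ‖x - T.pos j‖ < ‖x - T.pos b‖ then j else b) 0

open Classical in
/-- The vertices in the rewiring neighbourhood of a new state `x`, which is itself counted in the
number of vertices. -/
def nearVertices (C : Config) (T : Tree n) (x : State n) : List ℕ :=
  match C.rewire with
  | .radius r => (List.range T.num).filter
      (fun j => edist (T.pos j) x ≤ min C.maxEdge (r (T.num + 1)))
  | .nearest k => (List.range T.num).filter
      (fun j => ((Finset.range T.num).filter (fun l => ‖T.pos l - x‖ < ‖T.pos j - x‖ ∨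
        (‖T.pos l - x‖ = ‖T.pos j - x‖ ∧ l < j))).card < k (T.num + 1))

open Classical in
/-- The parent chosen for a new state `x`: starting from the nearest vertex `v`, each
neighbour that gives a cheaper collision-free connection replaces the current choice. -/
def chooseParent (P : Problem n) (C : Config) (T : Tree n) (v : ℕ) (x : State n) : ℕ :=
  (T.nearVertices C x).foldl
    (fun b j => if T.cost j + ‖T.pos j - x‖ < T.cost b + ‖T.pos b - x‖ ∧ P.IsFree (T.pos j) x
      then j else b) v

/-- The tree with a new vertex at `x` below the vertex `p`. -/
def insert (T : Tree n) (x : State n) (p : ℕ) : Tree n where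
  num := T.num + 1
  pos := Function.update T.pos T.num x
  parent := Function.update T.parent T.num p

open Classical in
/-- Vertex `i` becomes the parent of vertex `j` if that is collision-free and makes `j`
cheaper. -/
def rewireOne (P : Problem n) (i : ℕ) (T : Tree n) (j : ℕ) : Tree n :=
  if T.cost i + ‖T.pos i - T.pos j‖ < T.cost j ∧ P.IsFree (T.pos i) (T.pos j)
  then { T with parent := Function.update T.parent j i } else T

/-- Insert the new state `x`, whose nearest vertex is `v`, and rewire its neighbours one by
one. -/
def extend (P : Problem n) (C : Config) (T : Tree n) (v : ℕ) (x : State n) : Tree n :=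
  (T.nearVertices C x).foldl (rewireOne P T.num) (T.insert x (T.chooseParent P C v x))

open Classical in
/-- One iteration of RRT* with the sample `x`. Nothing happens if the connection is not free, or
if the new state already is a vertex. -/
def step (P : Problem n) (C : Config) (T : Tree n) (x : State n) : Tree n :=
  let v := T.nearestVertex x
  let y := steer C.maxEdge (T.pos v) x
  if P.IsFree (T.pos v) y ∧ ∀ j < T.num, T.pos j ≠ y then T.extend P C v y else T

end Tree

/-- The trees built by RRT* from the initial tree `T₀` and a sequence of samples. -/
def run {n : ℕ} (P : Problem n) (C : Config) (T₀ : Tree n) (x : ℕ → State n) : ℕ → Tree n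
  | 0 => T₀
  | i + 1 => (run P C T₀ x i).step P C (x i)

/-- The cost of the current solution after `i` iterations. -/
def solutionCost {n : ℕ} (P : Problem n) (C : Config) (T₀ : Tree n) (x : ℕ → State n) (i : ℕ) :
    ℝ≥0∞ :=
  (run P C T₀ x i).bestCost P

/-- The quotient of successive errors, whose limit is the rate of convergence of `a` to `l`.
(It is used only for `l ≤ a i`; it is meaningless if `a i = l` or `a i = ∞`.) -/
def errorRatio (a : ℕ → ℝ≥0∞) (l : ℝ≥0∞) (i : ℕ) : ℝ≥0∞ := (a (i + 1) - l) / (a i - l)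

/-- `a` eventually is finite and never equals its lower bound `l`, so that the quotients of
successive errors eventually make sense. -/
def HasErrorRatios (a : ℕ → ℝ≥0∞) (l : ℝ≥0∞) : Prop := (∃ i, a i < ⊤) ∧ ∀ i, l < a i

end RRTStar

end

/-! ### Trees: validity, costs, insertion and rewiring -/

namespace RRTStar

namespace Tree

variable {n : ℕ} {P : Problem n} {T : Tree n}

/-! Let `δ_i = (c_i - c_{i+1}) / (c_i - c*)` be the relative decrease of the error (`relDecrease`),
so that the error ratio is `1 - δ_i` and `0 ≤ δ_i ≤ 1`. Everything follows from the almost sure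
convergence to `0` of the mean of `δ_i` over the next sample (`ae_tendsto_lintegral_relDecrease`).
The costs decrease to a limit `L ≥ c*`, and there are two cases.

If `L > c*`, the denominators are at least `L - c*`, while the decreases telescope to a finite sum
once a solution exists. The means of a nonnegative sequence whose sum is bounded by a potential are
almost surely summable (`ae_tendsto_lintegral_of_potential`), hence tend to `0`.

If `L = c*`, only the probability of an improvement counts. An improved solution must pass through
the new vertex, which therefore lies on a collision-free polygonal solution of length less than
`c_i` (`steer_mem_chainSet`). If steering leaves the sample unchanged, the sample itself lies in
`chainSet c_i`. These sets decrease into the null set of optimal states, so their probabilities tend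
to `0`. If steering shortens the step, the new vertex is at distance at least `η` from all the
others. By packing in the bounded free space this happens boundedly often, and the potential
argument applies again (`exists_packing_potential`).

Continuity from above needs measurability of `chainSet c`. The obstacles are arbitrary, but the free
space is closed, so `chainSet c` is a countable union of projections of Borel sets. It is thus built
from analytic sets, and `nullMeasurableSet_of_analyticSet` applies.

The mean of `δ_i` over the whole run then tends to `0` by dominated convergence, and Fatou's lemma
shows that `liminf δ_i = 0` almost surely, which excludes every limit of the ratios other than `1`.
-/

theorem IsValid.iterate_root (h : T.IsValid P) (k : ℕ) : T.parent^[k] 0 = 0 :=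
  Function.iterate_fixed h.parent_root k

theorem IsValid.iterate_lt (h : T.IsValid P) {j : ℕ} (hj : j < T.num) (k : ℕ) :
    T.parent^[k] j < T.num := by
  induction k with
  | zero => exact hj
  | succ k ih => rw [Function.iterate_succ_apply']; exact h.parent_lt _ ih

/-- The path from a vertex to the root has fewer edges than the tree has vertices. -/
theorem IsValid.iterate_num (h : T.IsValid P) {j : ℕ} (hj : j < T.num) :
    T.parent^[T.num] j = 0 := by
  classical
  have hex := h.reaches_root j hj
  set k := Nat.find hex with hk
  have hk0 : T.parent^[k] j = 0 := Nat.find_spec hex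
  by_cases hle : k ≤ T.num
  · rw [← Nat.sub_add_cancel hle, Function.iterate_add_apply, hk0, h.iterate_root]
  · exfalso
    push Not at hle
    -- Two of the first `num + 1` ancestors coincide; cutting out the cycle between them contradicts
    -- the minimality of `k`.
    obtain ⟨a, ha, b, hb, hne, hab⟩ := Finset.exists_ne_map_eq_of_card_lt_of_maps_to
      (s := Finset.range (T.num + 1)) (t := Finset.range T.num)
      (f := fun k => T.parent^[k] j) (by simp)
      (fun k _ => by simpa using h.iterate_lt hj k)
    have key : ∀ a b : ℕ, b < T.num + 1 → a < b → T.parent^[a] j = T.parent^[b] j → False := by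
      intro a b hb hlt hab
      have h1 : T.parent^[k - b + a] j = 0 := by
        rw [Function.iterate_add_apply, hab, ← Function.iterate_add_apply,
          Nat.sub_add_cancel (by omega), hk0]
      have := Nat.find_min' hex h1
      omega
    rw [Finset.mem_range] at ha hb
    rcases lt_or_gt_of_ne hne with hlt | hlt
    · exact key a b hb hlt hab
    · exact key b a ha hlt hab.symm

theorem IsValid.induction (h : T.IsValid P) {motive : ℕ → Prop} (h0 : motive 0)
    (hs : ∀ j < T.num, j ≠ 0 → motive (T.parent j) → motive j) : ∀ j < T.num, motive j := by
  intro j hj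
  obtain ⟨k, hk⟩ := h.reaches_root j hj
  induction k generalizing j with
  | zero => rw [Function.iterate_zero, id] at hk; rwa [hk]
  | succ k ih =>
    by_cases hj0 : j = 0
    · rwa [hj0]
    · exact hs j hj hj0 (ih _ (h.parent_lt j hj) (by rwa [← Function.iterate_succ_apply]))

theorem cost_nonneg (T : Tree n) (j : ℕ) : 0 ≤ T.cost j :=
  Finset.sum_nonneg fun _ _ => norm_nonneg _

theorem IsValid.cost_root (h : T.IsValid P) : T.cost 0 = 0 :=
  Finset.sum_eq_zero fun k _ => by rw [h.iterate_root, h.iterate_root]; simp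

/-- The sum defining the cost may be extended by the summand `k = num`, which vanishes since both
its ends are the root. Splitting off the first summand instead of the last gives the recursion. -/
theorem IsValid.cost_eq (h : T.IsValid P) {j : ℕ} (hj : j < T.num) :
    T.cost j = T.cost (T.parent j) + ‖T.pos (T.parent j) - T.pos j‖ := by
  have e : T.parent^[T.num + 1] j = 0 := by
    rw [Function.iterate_succ_apply', h.iterate_num hj, h.parent_root]
  have h1 := Finset.sum_range_succ
    (fun k => ‖T.pos (T.parent^[k] j) - T.pos (T.parent^[k + 1] j)‖) T.num
  rw [Finset.sum_range_succ', e, h.iterate_num hj] at h1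
  simp only [sub_self, norm_zero, add_zero, zero_add, Function.iterate_zero, id,
    Function.iterate_one] at h1
  rw [norm_sub_rev (T.pos (T.parent j))]
  simpa only [cost, Function.iterate_succ_apply] using h1.symm

/-- Every function that decreases along each edge by at least its length is an upper bound for the
cost. -/
theorem IsValid.cost_le (h : T.IsValid P) {φ : ℕ → ℝ} (h0 : 0 ≤ φ 0)
    (hφ : ∀ j < T.num, j ≠ 0 → φ (T.parent j) + ‖T.pos (T.parent j) - T.pos j‖ ≤ φ j) :
    ∀ j < T.num, T.cost j ≤ φ j := by
  refine h.induction (by rwa [h.cost_root]) fun j hj hj0 ih => ?_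
  rw [h.cost_eq hj]
  linarith [hφ j hj hj0]

theorem IsValid.insert (h : T.IsValid P) {y : State n} {p : ℕ} (hp : p < T.num)
    (hfree : P.IsFree (T.pos p) y) : (T.insert y p).IsValid P := by
  have hpar : ∀ j < T.num, (T.insert y p).parent j = T.parent j := fun j hj =>
    Function.update_of_ne hj.ne _ _
  have hpos : ∀ j < T.num, (T.insert y p).pos j = T.pos j := fun j hj =>
    Function.update_of_ne hj.ne _ _
  have hparN : (T.insert y p).parent T.num = p := Function.update_self _ _ _
  have hposN : (T.insert y p).pos T.num = y := Function.update_self _ _ _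
  have hnum : (T.insert y p).num = T.num + 1 := rfl
  have hit : ∀ j < T.num, ∀ k, (T.insert y p).parent^[k] j = T.parent^[k] j := by
    intro j hj k
    induction k with
    | zero => rfl
    | succ k ih =>
      rw [Function.iterate_succ_apply', ih, hpar _ (h.iterate_lt hj k),
        Function.iterate_succ_apply']
  have hcase : ∀ j < (T.insert y p).num, j < T.num ∨ j = T.num := by
    intro j hj; rw [hnum] at hj; omega
  refine ⟨by rw [hnum]; omega, by rw [hpos 0 h.num_pos, h.pos_root],
    by rw [hpar 0 h.num_pos, h.parent_root], ?_, ?_, ?_, ?_⟩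
  · intro j hj
    rcases hcase j hj with hj | rfl
    · rw [hpar j hj, hnum]; have := h.parent_lt j hj; omega
    · rw [hparN, hnum]; omega
  · intro j hj
    rcases hcase j hj with hj | rfl
    · obtain ⟨k, hk⟩ := h.reaches_root j hj
      exact ⟨k, by rw [hit j hj, hk]⟩
    · obtain ⟨k, hk⟩ := h.reaches_root p hp
      exact ⟨k + 1, by rw [Function.iterate_succ_apply, hparN, hit p hp, hk]⟩
  · intro j hj
    rcases hcase j hj with hj | rfl
    · rw [hpos j hj]; exact h.pos_free j hj
    · rw [hposN]; exact hfree (right_mem_segment ℝ _ _)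
  · intro j hj
    rcases hcase j hj with hj | rfl
    · rw [hpos j hj, hpar j hj, hpos _ (h.parent_lt j hj)]; exact h.edge_free j hj
    · rw [hposN, hparN, hpos p hp]; exact hfree

theorem IsValid.cost_insert_le (h : T.IsValid P) {y : State n} {p : ℕ} (hp : p < T.num)
    (hfree : P.IsFree (T.pos p) y) {j : ℕ} (hj : j < T.num) :
    (T.insert y p).cost j ≤ T.cost j := by
  have h' := h.insert hp hfree
  have hpar : ∀ j < T.num, (T.insert y p).parent j = T.parent j := fun j hj =>
    Function.update_of_ne hj.ne _ _
  have hpos : ∀ j < T.num, (T.insert y p).pos j = T.pos j := fun j hj =>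
    Function.update_of_ne hj.ne _ _
  refine h.induction (motive := fun j => (T.insert y p).cost j ≤ T.cost j) ?_ ?_ j hj
  · rw [h'.cost_root, h.cost_root]
  · intro j hj _ ih
    rw [h'.cost_eq (j := j) (Nat.lt_succ_of_lt hj), h.cost_eq hj, hpar j hj, hpos j hj,
      hpos _ (h.parent_lt j hj)]
    linarith

/-- Rewiring preserves validity and does not increase any cost. -/
theorem IsValid.rewireOne (h : T.IsValid P) {i j : ℕ} (hi : i < T.num) :
    (T.rewireOne P i j).IsValid P ∧
      ∀ l < T.num, (T.rewireOne P i j).cost l ≤ T.cost l := by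
  unfold Tree.rewireOne
  split_ifs with hc
  swap
  · exact ⟨h, fun l _ => le_rfl⟩
  obtain ⟨hlt, hfree⟩ := hc
  set T' : Tree n := { T with parent := Function.update T.parent j i } with hT'
  have hj0 : j ≠ 0 := by
    rintro rfl
    rw [h.cost_root] at hlt
    have := T.cost_nonneg i
    have := norm_nonneg (T.pos i - T.pos 0)
    linarith
  have hpar : ∀ l, l ≠ j → T'.parent l = T.parent l := fun l hl => Function.update_of_ne hl _ _
  have hparj : T'.parent j = i := Function.update_self _ _ _
  have hpos : T'.pos = T.pos := rfl
  have hnum : T'.num = T.num := rfl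
  have hstep : ∀ l, (∃ k, T'.parent^[k] (T'.parent l) = 0) → ∃ k, T'.parent^[k] l = 0 :=
    fun l ⟨k, hk⟩ => ⟨k + 1, by rwa [Function.iterate_succ_apply]⟩
  -- No cycle arises: costs do not increase towards the root, so the path of a vertex cheaper than
  -- `j` avoids `j` and survives the rewiring. The new parent `i` is such a vertex.
  have hreach1 : ∀ l < T.num, T.cost l < T.cost j → ∃ k, T'.parent^[k] l = 0 := by
    refine h.induction (fun _ => ⟨0, rfl⟩) fun l hl _ ih hlj => hstep l ?_
    have hne : l ≠ j := by rintro rfl; exact lt_irrefl _ hlj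
    rw [hpar l hne]
    refine ih ?_
    have := h.cost_eq hl
    have := norm_nonneg (T.pos (T.parent l) - T.pos l)
    linarith
  have hreach : ∀ l < T.num, ∃ k, T'.parent^[k] l = 0 := by
    refine h.induction ⟨0, rfl⟩ fun l hl _ ih => hstep l ?_
    by_cases hlj : l = j
    · rw [hlj, hparj]
      refine hreach1 i hi ?_
      have := norm_nonneg (T.pos i - T.pos j)
      linarith
    · rwa [hpar l hlj]
  have hval : T'.IsValid P := by
    refine ⟨h.num_pos, h.pos_root, by rw [hpar 0 hj0.symm, h.parent_root], ?_, hreach,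
      h.pos_free, ?_⟩
    · intro l hl
      by_cases hlj : l = j
      · rw [hlj, hparj]; exact hi
      · rw [hpar l hlj]; exact h.parent_lt l hl
    · intro l hl
      by_cases hlj : l = j
      · rw [hlj, hparj]; exact hfree
      · rw [hpar l hlj]; exact h.edge_free l hl
  -- The old costs are an admissible `φ` for the new tree: the inequality is strict at `j` and an
  -- equality elsewhere.
  refine ⟨hval, hval.cost_le (by rw [h.cost_root]) fun l hl _ => ?_⟩
  by_cases hlj : l = j
  · rw [hlj, hparj]; exact hlt.le
  · rw [hpar l hlj, hpos, ← h.cost_eq hl]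

theorem foldl_argmin {ι : Type*} (f : ι → ℝ) [DecidableRel fun a b => f a < f b] (l : List ι)
    (b : ι) : (l.foldl (fun b j => if f j < f b then j else b) b = b ∨
        l.foldl (fun b j => if f j < f b then j else b) b ∈ l) ∧
      f (l.foldl (fun b j => if f j < f b then j else b) b) ≤ f b ∧
      ∀ a ∈ l, f (l.foldl (fun b j => if f j < f b then j else b) b) ≤ f a := by
  induction l generalizing b with
  | nil => simp
  | cons c l ih =>
    rw [List.foldl_cons]
    obtain ⟨h1, h2, h3⟩ := ih (if f c < f b then c else b)
    have hb : f (if f c < f b then c else b) ≤ f b := by split_ifs with h <;> linarith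
    have hc : f (if f c < f b then c else b) ≤ f c := by split_ifs with h <;> linarith
    refine ⟨?_, h2.trans hb, ?_⟩
    · rcases h1 with h1 | h1
      · rw [h1]; split_ifs <;> simp
      · exact Or.inr (List.mem_cons_of_mem _ h1)
    · intro a ha
      rcases List.mem_cons.1 ha with rfl | ha
      · exact h2.trans hc
      · exact h3 a ha

theorem nearestVertex_spec (hT : 0 < T.num) (x : State n) :
    T.nearestVertex x < T.num ∧
      ∀ j < T.num, ‖x - T.pos (T.nearestVertex x)‖ ≤ ‖x - T.pos j‖ := by
  classical
  obtain ⟨h1, -, h3⟩ := foldl_argmin (fun j => ‖x - T.pos j‖) (List.range T.num) 0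
  refine ⟨?_, fun j hj => ?_⟩
  · unfold nearestVertex
    rcases h1 with h1 | h1
    · convert! hT
    · convert! List.mem_range.1 h1
  · unfold nearestVertex
    convert! h3 j (List.mem_range.2 hj)

theorem lt_of_mem_nearVertices {C : Config} {x : State n} {j : ℕ}
    (hj : j ∈ T.nearVertices C x) : j < T.num := by
  unfold nearVertices at hj
  split at hj <;> exact List.mem_range.1 (List.mem_filter.1 hj).1

/-- Only the validity of the chosen parent matters for the convergence rate; how cheap it is plays
no role. -/
theorem chooseParent_spec {C : Config} {v : ℕ} {x : State n} (hv : v < T.num)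
    (hfree : P.IsFree (T.pos v) x) :
    T.chooseParent P C v x < T.num ∧ P.IsFree (T.pos (T.chooseParent P C v x)) x := by
  unfold chooseParent
  refine List.foldlRecOn (motive := fun b => b < T.num ∧ P.IsFree (T.pos b) x)
    (T.nearVertices C x) _ ⟨hv, hfree⟩ fun b hb a ha => ?_
  split_ifs with h
  · exact ⟨lt_of_mem_nearVertices ha, h.2⟩
  · exact hb

/-- `T'` is a valid tree that arises from `T` by the insertion of the vertex `y` and rewiring to
the new vertex, without any increase of costs. -/
structure IsExtension (P : Problem n) (T T' : Tree n) (y : State n) : Prop where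
  valid : T'.IsValid P
  num_eq : T'.num = T.num + 1
  pos_eq : ∀ j < T.num, T'.pos j = T.pos j
  pos_new : T'.pos T.num = y
  parent_eq : ∀ j < T.num, T'.parent j = T.parent j ∨ T'.parent j = T.num
  cost_le : ∀ j < T.num, T'.cost j ≤ T.cost j

theorem rewireOne_num (P : Problem n) (i j : ℕ) (T : Tree n) :
    (T.rewireOne P i j).num = T.num := by
  unfold rewireOne; split_ifs <;> rfl

theorem rewireOne_pos (P : Problem n) (i j : ℕ) (T : Tree n) :
    (T.rewireOne P i j).pos = T.pos := by
  unfold rewireOne; split_ifs <;> rfl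

theorem rewireOne_parent (P : Problem n) (i j : ℕ) (T : Tree n) (l : ℕ) :
    (T.rewireOne P i j).parent l = T.parent l ∨ (T.rewireOne P i j).parent l = i := by
  unfold rewireOne
  split_ifs
  · by_cases h : l = j
    · exact Or.inr (by rw [h]; exact Function.update_self _ _ _)
    · exact Or.inl (Function.update_of_ne h _ _)
  · exact Or.inl rfl

theorem IsValid.extend (h : T.IsValid P) (C : Config) {v : ℕ} {y : State n} (hv : v < T.num)
    (hfree : P.IsFree (T.pos v) y) : IsExtension P T (T.extend P C v y) y := by
  obtain ⟨hp, hpf⟩ := chooseParent_spec (C := C) hv hfree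
  unfold Tree.extend
  refine List.foldlRecOn (motive := fun T' => IsExtension P T T' y)
    (T.nearVertices C y) _ ?_ fun T' hT' a _ => ?_
  · exact ⟨h.insert hp hpf, rfl, fun j hj => Function.update_of_ne hj.ne _ _,
      Function.update_self _ _ _, fun j hj => Or.inl (Function.update_of_ne hj.ne _ _),
      fun j hj => h.cost_insert_le hp hpf hj⟩
  · have hN : T.num < T'.num := by rw [hT'.num_eq]; omega
    obtain ⟨h1, h2⟩ := hT'.valid.rewireOne (j := a) hN
    refine ⟨h1, by rw [rewireOne_num, hT'.num_eq], fun j hj => by rw [rewireOne_pos, hT'.pos_eq j hj],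
      by rw [rewireOne_pos, hT'.pos_new], fun j hj => ?_,
      fun j hj => (h2 j (by omega)).trans (hT'.cost_le j hj)⟩
    rcases rewireOne_parent P T.num a T' j with e | e
    · rw [e]; exact hT'.parent_eq j hj
    · exact Or.inr e

theorem bestCost_le {T : Tree n} {j : ℕ} (hj : j < T.num) (hg : T.pos j ∈ P.goal) :
    T.bestCost P ≤ ENNReal.ofReal (T.cost j) :=
  iInf₂_le j ⟨hj, hg⟩

theorem exists_cost_lt_of_bestCost_lt {T : Tree n} {c : ℝ≥0∞} (h : T.bestCost P < c) :
    ∃ j < T.num, T.pos j ∈ P.goal ∧ ENNReal.ofReal (T.cost j) < c := by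
  unfold bestCost at h
  simp only [iInf_lt_iff] at h
  obtain ⟨j, ⟨hj, hg⟩, hc⟩ := h
  exact ⟨j, hj, hg, hc⟩

theorem IsExtension.bestCost_le {T' : Tree n} {y : State n} (h : IsExtension P T T' y) :
    T'.bestCost P ≤ T.bestCost P :=
  le_iInf₂ fun j hj => (Tree.bestCost_le (by rw [h.num_eq]; omega)
    (by rw [h.pos_eq j hj.1]; exact hj.2)).trans (ENNReal.ofReal_le_ofReal (h.cost_le j hj.1))

/-- Vertices whose path avoids the new vertex keep their cost. -/
theorem IsExtension.cost_eq_or {T' : Tree n} {y : State n} (h : IsExtension P T T' y)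
    (hT : T.IsValid P) : ∀ j < T'.num, (j < T.num ∧ T'.cost j = T.cost j) ∨
      ∃ k, T'.parent^[k] j = T.num := by
  refine h.valid.induction (Or.inl ⟨hT.num_pos, by rw [h.valid.cost_root, hT.cost_root]⟩) ?_
  intro j hj _ ih
  rcases ih with ⟨hlt, hc⟩ | ⟨k, hk⟩
  · by_cases hjN : j = T.num
    · exact Or.inr ⟨0, hjN⟩
    · have hj' : j < T.num := by rw [h.num_eq] at hj; omega
      rcases h.parent_eq j hj' with e | e
      · refine Or.inl ⟨hj', ?_⟩
        rw [h.valid.cost_eq hj, hT.cost_eq hj', hc, e, h.pos_eq j hj', h.pos_eq _ (by rwa [← e])]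
      · exact Or.inr ⟨1, e⟩
  · exact Or.inr ⟨k + 1, by rwa [Function.iterate_succ_apply]⟩

/-- An improved solution passes through the new vertex. -/
theorem IsExtension.exists_of_bestCost_lt {T' : Tree n} {y : State n} (h : IsExtension P T T' y)
    (hT : T.IsValid P) (hlt : T'.bestCost P < T.bestCost P) :
    ∃ j < T'.num, T'.pos j ∈ P.goal ∧ ENNReal.ofReal (T'.cost j) < T.bestCost P ∧
      ∃ k, T'.pos (T'.parent^[k] j) = y := by
  obtain ⟨j, hj, hg, hc⟩ := exists_cost_lt_of_bestCost_lt hlt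
  refine ⟨j, hj, hg, hc, ?_⟩
  rcases h.cost_eq_or hT j hj with ⟨hjN, e⟩ | ⟨k, hk⟩
  · rw [e] at hc
    rw [h.pos_eq j hjN] at hg
    exact absurd hc (not_lt.2 (Tree.bestCost_le hjN hg))
  · exact ⟨k, by rw [hk, h.pos_new]⟩

theorem IsValid.step_cases (h : T.IsValid P) (C : Config) (x : State n) :
    T.step P C x = T ∨
      (P.IsFree (T.pos (T.nearestVertex x)) (steer C.maxEdge (T.pos (T.nearestVertex x)) x) ∧
        IsExtension P T (T.step P C x) (steer C.maxEdge (T.pos (T.nearestVertex x)) x)) := by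
  have hv := (nearestVertex_spec h.num_pos x).1
  unfold Tree.step
  simp only
  split_ifs with hc
  · exact Or.inr ⟨hc.1, h.extend C hv hc.1⟩
  · exact Or.inl rfl

theorem IsValid.step (h : T.IsValid P) (C : Config) (x : State n) : (T.step P C x).IsValid P := by
  rcases h.step_cases C x with e | ⟨-, e⟩
  · rwa [e]
  · exact e.valid

theorem IsValid.bestCost_step_le (h : T.IsValid P) (C : Config) (x : State n) :
    (T.step P C x).bestCost P ≤ T.bestCost P := by
  rcases h.step_cases C x with e | ⟨-, e⟩
  · rw [e]
  · exact e.bestCost_le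

end Tree

theorem isValid_run {n : ℕ} {P : Problem n} (C : Config) {T₀ : Tree n} (h : T₀.IsValid P)
    (x : ℕ → State n) (i : ℕ) : (run P C T₀ x i).IsValid P := by
  induction i with
  | zero => exact h
  | succ i ih => exact ih.step C (x i)

end RRTStar

/-! ### Paths, polygonal solutions and optimal states -/

namespace RRTStar

namespace Problem

variable {n : ℕ} {P : Problem n}

theorem IsPath.exists_concat {σ τ : ℝ → State n} (hσ : P.IsPath σ) (hτ : P.IsPath τ)
    (h : σ 1 = τ 0) : ∃ υ, P.IsPath υ ∧ υ 0 = σ 0 ∧ υ 1 = τ 1 ∧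
      pathLength υ ≤ pathLength σ + pathLength τ := by
  set υ : ℝ → State n := fun t => if t ≤ 1 / 2 then σ (2 * t) else τ (2 * t - 1) with hυ
  have e1 : Set.EqOn υ (σ ∘ fun t => 2 * t) (Set.Icc 0 (1 / 2)) := fun t ht => by
    simp only [hυ, Function.comp, if_pos ht.2]
  have e2 : Set.EqOn υ (τ ∘ fun t => 2 * t - 1) (Set.Icc (1 / 2) 1) := fun t ht => by
    by_cases h' : t ≤ 1 / 2
    · have : t = 1 / 2 := le_antisymm h' ht.1
      subst this
      simp only [hυ, Function.comp, if_pos le_rfl]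
      norm_num [h]
    · simp only [hυ, Function.comp, if_neg h']
  have m1 : Set.MapsTo (fun t : ℝ => 2 * t) (Set.Icc 0 (1 / 2)) (Set.Icc 0 1) := fun t ht =>
    ⟨by linarith [ht.1], by linarith [ht.2]⟩
  have m2 : Set.MapsTo (fun t : ℝ => 2 * t - 1) (Set.Icc (1 / 2) 1) (Set.Icc 0 1) := fun t ht =>
    ⟨by linarith [ht.1], by linarith [ht.2]⟩
  have hU : Set.Icc (0 : ℝ) (1 / 2) ∪ Set.Icc (1 / 2) 1 = Set.Icc 0 1 :=
    Set.Icc_union_Icc_eq_Icc (by norm_num) (by norm_num)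
  refine ⟨υ, ⟨?_, fun t ht => ?_⟩, ?_, ?_, ?_⟩
  · rw [← hU]
    refine ContinuousOn.union_of_isClosed ?_ ?_ isClosed_Icc isClosed_Icc
    · exact (hσ.1.comp (by fun_prop) m1).congr e1
    · exact (hτ.1.comp (by fun_prop) m2).congr e2
  · rw [← hU] at ht
    rcases ht with ht | ht
    · rw [e1 ht]; exact hσ.2 _ (m1 ht)
    · rw [e2 ht]; exact hτ.2 _ (m2 ht)
  · simp [hυ]
  · rw [e2 ⟨by norm_num, le_rfl⟩]; norm_num
  · have e : pathLength υ = eVariationOn (σ ∘ fun t => 2 * t) (Set.Icc 0 (1 / 2)) +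
        eVariationOn (τ ∘ fun t => 2 * t - 1) (Set.Icc (1 / 2) 1) := by
      unfold pathLength
      rw [← hU, eVariationOn.union υ (isGreatest_Icc (by norm_num)) (isLeast_Icc (by norm_num)),
        eVariationOn.congr e1, eVariationOn.congr e2]
    rw [e]
    exact add_le_add
      (eVariationOn.comp_le_of_monotoneOn σ _ (fun a _ b _ hab => by linarith) m1)
      (eVariationOn.comp_le_of_monotoneOn τ _ (fun a _ b _ hab => by linarith) m2)

theorem IsFree.exists_path {v w : State n} (h : P.IsFree v w) :
    ∃ σ, P.IsPath σ ∧ σ 0 = v ∧ σ 1 = w ∧ pathLength σ ≤ ENNReal.ofReal ‖v - w‖ := by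
  refine ⟨AffineMap.lineMap v w, ⟨AffineMap.lineMap_continuous.continuousOn, fun t ht => h ?_⟩,
    by simp, by simp, ?_⟩
  · rw [segment_eq_image_lineMap]; exact ⟨t, ht, rfl⟩
  · have hl : LipschitzOnWith (nndist v w) (AffineMap.lineMap v w : ℝ → State n) Set.univ :=
      (lipschitzWith_lineMap v w).lipschitzOnWith
    have := hl.comp_eVariationOn_le (g := (id : ℝ → ℝ)) (s := Set.Icc 0 1) (Set.mapsTo_univ _ _)
    refine this.trans ?_
    have h1 := ((monotone_id (α := ℝ)).monotoneOn (Set.Icc 0 1)).eVariationOn_eq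
      (a := 0) (b := 1) (by simp) (by simp)
    rw [Set.inter_self] at h1
    rw [h1, id, id, sub_zero, ENNReal.ofReal_one, mul_one, ← edist_nndist, edist_dist,
      dist_eq_norm]

theorem exists_path_of_chain {p : ℕ → State n} {a b : ℕ} (hab : a ≤ b) (ha : p a ∈ P.free)
    (hp : ∀ i < b, P.IsFree (p i) (p (i + 1))) :
    ∃ σ, P.IsPath σ ∧ σ 0 = p a ∧ σ 1 = p b ∧
      pathLength σ ≤ ENNReal.ofReal (∑ i ∈ Finset.Ico a b, ‖p i - p (i + 1)‖) := by
  induction b, hab using Nat.le_induction with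
  | base =>
    refine ⟨fun _ => p a, ⟨continuousOn_const, fun _ _ => ha⟩, rfl, rfl, ?_⟩
    refine (eVariationOn.constant_on ?_).le.trans zero_le
    exact Set.Subsingleton.anti Set.subsingleton_singleton (Set.image_subset_iff.2 fun _ _ => rfl)
  | succ b hab ih =>
    obtain ⟨σ, h1, h2, h3, h4⟩ := ih fun i hi => hp i (by omega)
    obtain ⟨τ, k1, k2, k3, k4⟩ := (hp b (by omega)).exists_path
    obtain ⟨υ, l1, l2, l3, l4⟩ := h1.exists_concat k1 (h3.trans k2.symm)
    refine ⟨υ, l1, l2.trans h2, l3.trans k3, l4.trans ?_⟩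
    rw [Finset.sum_Ico_succ_top hab, ENNReal.ofReal_add
      (Finset.sum_nonneg fun _ _ => norm_nonneg _) (norm_nonneg _)]
    exact add_le_add h4 k4

/-- Collision-free polygonal solutions with `m` edges and length less than `c`. -/
def chains (P : Problem n) (m : ℕ) (c : ℝ≥0∞) : Set (ℕ → State n) :=
  {p | p 0 = P.start ∧ (∀ i < m, P.IsFree (p i) (p (i + 1))) ∧ p m ∈ P.goal ∧
    ENNReal.ofReal (∑ i ∈ Finset.range m, ‖p i - p (i + 1)‖) < c}

/-- The vertices of polygonal solutions of length less than `c`. -/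
def chainSet (P : Problem n) (c : ℝ≥0∞) : Set (State n) :=
  ⋃ (m : ℕ), ⋃ (k : Fin (m + 1)), (fun p => p k) '' P.chains m c

theorem mem_chainSet {c : ℝ≥0∞} {y : State n} {m k : ℕ} {p : ℕ → State n} (hk : k ≤ m)
    (hp : p ∈ P.chains m c) (hy : p k = y) : y ∈ P.chainSet c :=
  Set.mem_iUnion₂.2 ⟨m, ⟨k, by omega⟩, p, hp, hy⟩

theorem chainSet_mono : Monotone P.chainSet := by
  intro c d hcd y hy
  obtain ⟨m, k, p, ⟨h1, h2, h3, h4⟩, rfl⟩ := Set.mem_iUnion₂.1 hy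
  exact mem_chainSet (Nat.lt_succ_iff.1 k.2) ⟨h1, h2, h3, h4.trans_le hcd⟩ rfl

/-- Concatenate paths to and from `x` that are optimal up to `ε / 2`; the infima need not be
attained. -/
theorem optCost_le (x : State n) : P.optCost ≤ P.costToCome x + P.costToGo x := by
  refine ENNReal.le_of_forall_pos_le_add fun ε hε hfin => ?_
  obtain ⟨h1, h2⟩ := ENNReal.add_lt_top.1 hfin
  have hε2 : (ε : ℝ≥0∞) / 2 ≠ 0 := by simp [hε.ne']
  obtain ⟨σ, hσ⟩ := iInf_lt_iff.1 (ENNReal.lt_add_right h1.ne hε2)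
  obtain ⟨⟨a1, a2, a3⟩, a4⟩ := iInf_lt_iff.1 hσ
  obtain ⟨τ, hτ⟩ := iInf_lt_iff.1 (ENNReal.lt_add_right h2.ne hε2)
  obtain ⟨⟨b1, b2, b3⟩, b4⟩ := iInf_lt_iff.1 hτ
  obtain ⟨υ, l1, l2, l3, l4⟩ := a1.exists_concat b1 (a3.trans b2.symm)
  calc P.optCost ≤ pathLength υ := iInf₂_le υ ⟨l1, l2.trans a2, l3 ▸ b3⟩
    _ ≤ (P.costToCome x + ε / 2) + (P.costToGo x + ε / 2) := l4.trans (add_le_add a4.le b4.le)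
    _ = P.costToCome x + P.costToGo x + ε := by
      rw [add_add_add_comm, ENNReal.add_halves]

/-- The vertex cuts the polygonal solution into a path from the start and a path to the goal, whose
lengths add up. -/
theorem mem_free_of_mem_chainSet {c : ℝ≥0∞} {y : State n} (hy : y ∈ P.chainSet c) :
    y ∈ P.free ∧ P.costToCome y + P.costToGo y < c := by
  obtain ⟨m, k, p, ⟨h1, h2, h3, h4⟩, rfl⟩ := Set.mem_iUnion₂.1 hy
  have hk : (k : ℕ) ≤ m := Nat.lt_succ_iff.1 k.2
  have h0 : p 0 ∈ P.free := h1 ▸ P.start_mem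
  obtain ⟨σ, a1, a2, a3, a4⟩ := exists_path_of_chain (Nat.zero_le k) h0
    fun i hi => h2 i (by omega)
  have hkf : p k ∈ P.free := a3 ▸ a1.2 1 (by simp)
  obtain ⟨τ, b1, b2, b3, b4⟩ := exists_path_of_chain hk hkf h2
  refine ⟨hkf, lt_of_le_of_lt (add_le_add ((iInf₂_le σ ⟨a1, a2.trans h1, a3⟩).trans a4)
    ((iInf₂_le τ ⟨b1, b2, b3 ▸ h3⟩).trans b4)) ?_⟩
  rw [← ENNReal.ofReal_add (Finset.sum_nonneg fun _ _ => norm_nonneg _)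
    (Finset.sum_nonneg fun _ _ => norm_nonneg _),
    Finset.sum_Ico_consecutive _ (Nat.zero_le _) hk, Nat.Ico_zero_eq_range]
  exact h4

/-- The cost through `y` is below every `c i`, hence at most the optimum in the limit, and it is
never less. -/
theorem mem_optimalStates_of_tendsto {c : ℕ → ℝ≥0∞} (hc : Tendsto c atTop (𝓝 P.optCost))
    {y : State n} (hy : ∀ i, y ∈ P.chainSet (c i)) : y ∈ P.optimalStates :=
  ⟨(mem_free_of_mem_chainSet (hy 0)).1, le_antisymm
    (ge_of_tendsto' hc fun i => (mem_free_of_mem_chainSet (hy i)).2.le) (optCost_le y)⟩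

/-- The optimum is at most the distance from start to goal, so an optimal state gives equality in
the triangle inequality and lies on the line through both. For `n ≥ 2` this is a proper affine
subspace. -/
theorem volume_optimalStates_of_isFree (hn : 2 ≤ n) {xg : State n} (hg : P.goal = {xg})
    (hfree : P.IsFree P.start xg) : volume P.optimalStates = 0 := by
  have hsub : P.optimalStates ⊆ (line[ℝ, P.start, xg] : Set (State n)) := by
    rintro x ⟨-, hx⟩
    have h1 : edist P.start x ≤ P.costToCome x := le_iInf₂ fun σ hσ => by
      rw [← hσ.2.1, ← hσ.2.2]
      exact eVariationOn.edist_le σ (by simp) (by simp)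
    have h2 : edist x xg ≤ P.costToGo x := le_iInf₂ fun σ hσ => by
      have e : σ 1 = xg := by simpa [hg] using hσ.2.2
      rw [← hσ.2.1, ← e]
      exact eVariationOn.edist_le σ (by simp) (by simp)
    have h3 : P.optCost ≤ edist P.start xg := by
      obtain ⟨σ, a1, a2, a3, a4⟩ := hfree.exists_path
      refine (iInf₂_le σ ⟨a1, a2, by simp [hg, a3]⟩).trans (a4.trans ?_)
      rw [edist_dist, dist_eq_norm]
    have h4 := (add_le_add h1 h2).trans (hx.le.trans h3)
    rw [edist_dist, edist_dist, edist_dist, ← ENNReal.ofReal_add dist_nonneg dist_nonneg,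
      ENNReal.ofReal_le_ofReal_iff dist_nonneg] at h4
    have h5 := le_antisymm h4 (dist_triangle _ _ _)
    exact (dist_add_dist_eq_iff.1 h5).mem_affineSpan
  refine measure_mono_null hsub (Measure.addHaar_affineSubspace _ _ fun htop => ?_)
  have h1 := (collinear_pair ℝ P.start xg).finrank_le_one
  rw [← direction_affineSpan, htop, AffineSubspace.direction_top, finrank_top,
    finrank_euclideanSpace_fin] at h1
  omega

end Problem

namespace Tree

variable {n : ℕ} {P : Problem n} {T : Tree n}

/-- The path from `j` to the root, read backwards, is a polygonal solution. It is given exactly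
`num` edges by padding with trivial edges at the root, which is its own parent. -/
theorem IsValid.mem_chainSet (h : T.IsValid P) {j : ℕ} (hj : j < T.num) (hg : T.pos j ∈ P.goal)
    {c : ℝ≥0∞} (hc : ENNReal.ofReal (T.cost j) < c) (k : ℕ) :
    T.pos (T.parent^[k] j) ∈ P.chainSet c := by
  have hk : T.parent^[k] j = T.parent^[min k T.num] j := by
    rcases le_total k T.num with hle | hle
    · rw [min_eq_left hle]
    · rw [min_eq_right hle, h.iterate_num hj, ← Nat.sub_add_cancel hle,
        Function.iterate_add_apply, h.iterate_num hj, h.iterate_root]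
  rw [hk]
  have hstep : ∀ i < T.num, T.parent^[T.num - i] j = T.parent (T.parent^[T.num - 1 - i] j) ∧
      T.num - (i + 1) = T.num - 1 - i := by
    intro i hi
    rw [← Function.iterate_succ_apply' T.parent]
    exact ⟨by congr 2; omega, by omega⟩
  refine Problem.mem_chainSet (m := T.num) (k := T.num - min k T.num)
    (p := fun i => T.pos (T.parent^[T.num - i] j)) (Nat.sub_le _ _) ⟨?_, ?_, ?_, ?_⟩ ?_
  · simp only [Nat.sub_zero]; rw [h.iterate_num hj, h.pos_root]
  · intro i hi
    simp only
    rw [(hstep i hi).1, (hstep i hi).2]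
    exact h.edge_free _ (h.iterate_lt hj _)
  · simpa using hg
  · convert hc using 2
    rw [cost, ← Finset.sum_range_reflect
      (fun k => ‖T.pos (T.parent^[k] j) - T.pos (T.parent^[k + 1] j)‖)]
    refine Finset.sum_congr rfl fun i hi => ?_
    have hi := Finset.mem_range.1 hi
    simp only
    rw [(hstep i hi).1, (hstep i hi).2, norm_sub_rev, Function.iterate_succ_apply']
  · congr 3
    omega

theorem IsValid.optCost_le (h : T.IsValid P) : P.optCost ≤ T.bestCost P := by
  by_contra! hlt
  obtain ⟨j, hj, hg, hc⟩ := exists_cost_lt_of_bestCost_lt hlt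
  have := (Problem.mem_free_of_mem_chainSet (h.mem_chainSet hj hg hc 0)).2
  exact absurd (Problem.optCost_le _) (not_le.2 this)

/-- An improvement requires the new vertex to lie on a polygonal solution that is better than the
current one. -/
theorem IsValid.steer_mem_chainSet (h : T.IsValid P) (C : Config) (x : State n)
    (hlt : (T.step P C x).bestCost P < T.bestCost P) :
    steer C.maxEdge (T.pos (T.nearestVertex x)) x ∈ P.chainSet (T.bestCost P) := by
  rcases h.step_cases C x with e | ⟨-, e⟩
  · rw [e] at hlt; exact absurd hlt (lt_irrefl _)
  · obtain ⟨j, hj, hg, hc, k, hk⟩ := e.exists_of_bestCost_lt h hlt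
    rw [← hk]
    exact e.valid.mem_chainSet hj hg hc k

end Tree

end RRTStar

/-! ### Null measurability of analytic sets and of `chainSet` -/

namespace RRTStar

/-- An analytic set can be approximated in measure by compact subsets. -/
theorem exists_isCompact_le_measure_range {α : Type*} [TopologicalSpace α] [MeasurableSpace α]
    (μ : Measure α) [μ.OuterRegular] {f : (ℕ → ℕ) → α} (hf : Continuous f) {t : ℝ≥0∞}
    (ht : t < μ (Set.range f)) : ∃ K ⊆ Set.range f, IsCompact K ∧ t ≤ μ K := by
  -- Bounding one more coordinate keeps the outer measure of the image above `t`: continuity from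
  -- below along increasing unions needs no measurability.
  have step : ∀ (k : ℕ) (S : {S : Set (ℕ → ℕ) // t < μ (f '' S)}),
      ∃ m, t < μ (f '' (S.1 ∩ {x | x k ≤ m})) := by
    intro k S
    have hmono : Monotone fun m => f '' (S.1 ∩ {x | x k ≤ m}) := fun a b hab =>
      Set.image_mono (Set.inter_subset_inter_right _ fun x (hx : x k ≤ a) => hx.trans hab)
    have hU : f '' S.1 = ⋃ m, f '' (S.1 ∩ {x | x k ≤ m}) := by
      rw [← Set.image_iUnion, ← Set.inter_iUnion]
      congr 1
      exact (Set.inter_eq_left.2 fun x _ => Set.mem_iUnion.2 ⟨x k, le_refl (x k)⟩).symm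
    have h := S.2
    rw [hU, hmono.measure_iUnion] at h
    exact lt_iSup_iff.1 h
  choose m hm using step
  let S : ℕ → {S : Set (ℕ → ℕ) // t < μ (f '' S)} := fun k =>
    Nat.rec ⟨Set.univ, by rwa [Set.image_univ]⟩ (fun k S => ⟨S.1 ∩ {x | x k ≤ m k S}, hm k S⟩) k
  set b : ℕ → ℕ := fun k => m k (S k) with hb
  have hS : ∀ k, (S k).1 = {x | ∀ i < k, x i ≤ b i} := by
    intro k
    induction k with
    | zero => ext x; simp [S]
    | succ k ih =>
      have : (S (k + 1)).1 = (S k).1 ∩ {x | x k ≤ b k} := rfl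
      rw [this, ih]
      ext x
      simp only [Set.mem_inter_iff, Set.mem_ofPred_eq, Nat.lt_succ_iff_lt_or_eq]
      constructor
      · rintro ⟨h1, h2⟩ i (hi | rfl)
        · exact h1 i hi
        · exact h2
      · exact fun h => ⟨fun i hi => h i (Or.inl hi), h k (Or.inr rfl)⟩
  have hC : IsCompact (Set.univ.pi fun i => Set.Iic (b i)) :=
    isCompact_univ_pi fun i => (Set.finite_Iic (b i)).isCompact
  refine ⟨f '' Set.univ.pi fun i => Set.Iic (b i), Set.image_subset_range _ _, hC.image hf, ?_⟩
  -- Otherwise an open `U` of measure less than `t` contains the image of the box. Each `S k`, which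
  -- bounds only the first `k` coordinates, then has a point mapped outside `U`, and these points
  -- accumulate in the box.
  by_contra! hlt
  obtain ⟨U, hKU, hUo, hU⟩ := Set.exists_isOpen_lt_of_lt _ t hlt
  have hex : ∀ k, ∃ x ∈ (S k).1, f x ∉ U := by
    intro k
    by_contra! hk
    exact absurd ((S k).2.trans_le (measure_mono (Set.image_subset_iff.2 hk))) (not_lt.2 hU.le)
  choose x hxS hxU using hex
  -- Setting the coordinates from `k` on to `0` moves the points into the compact box without
  -- affecting coordinatewise limits.
  obtain ⟨z, hz, φ, hφ, hlim⟩ := hC.tendsto_subseq (x := fun k i => if i < k then x k i else 0)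
    fun k i _ => by
      have := hxS k
      rw [hS] at this
      simp only [Set.mem_Iic]
      split_ifs with hi
      · exact this i hi
      · exact Nat.zero_le _
  have hlim' : Tendsto (x ∘ φ) atTop (𝓝 z) := by
    rw [tendsto_pi_nhds] at hlim ⊢
    intro i
    refine (hlim i).congr' ?_
    filter_upwards [eventually_gt_atTop i] with k hk
    simp [lt_of_lt_of_le hk hφ.le_apply]
  have hzU : z ∈ f ⁻¹' U := hKU (Set.mem_image_of_mem f hz)
  obtain ⟨k, hk⟩ := (hlim'.eventually ((hUo.preimage hf).mem_nhds hzU)).exists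
  exact hxU _ hk

/-- Analytic sets are measurable up to null sets. -/
theorem nullMeasurableSet_of_analyticSet {α : Type*} [TopologicalSpace α] [T2Space α]
    [MeasurableSpace α] [OpensMeasurableSpace α] (μ : Measure α) [IsFiniteMeasure μ]
    [μ.OuterRegular] {A : Set α} (hA : AnalyticSet A) : NullMeasurableSet A μ := by
  rw [AnalyticSet] at hA
  rcases hA with rfl | ⟨f, hf, rfl⟩
  · exact MeasurableSet.empty.nullMeasurableSet
  by_cases h0 : μ (Set.range f) = 0
  · exact NullMeasurableSet.of_null h0
  obtain ⟨t, -, ht, htlim⟩ := exists_seq_strictMono_tendsto' (pos_iff_ne_zero.2 h0)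
  choose K hKsub hKc hKt using fun i => exists_isCompact_le_measure_range μ hf (ht i).2
  have hBm : MeasurableSet (⋃ i, K i) := MeasurableSet.iUnion fun i => (hKc i).measurableSet
  have hBsub : ⋃ i, K i ⊆ Set.range f := Set.iUnion_subset hKsub
  have hle : μ (Set.range f) ≤ μ (⋃ i, K i) :=
    le_of_tendsto' htlim fun i => (hKt i).trans (measure_mono (Set.subset_iUnion K i))
  have hae := ae_eq_of_subset_of_measure_ge (hBsub.trans (subset_toMeasurable μ _))
    (by rwa [measure_toMeasurable]) hBm.nullMeasurableSet (measure_ne_top _ _)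
  rw [← Set.union_sdiff_cancel hBsub]
  refine hBm.nullMeasurableSet.union (NullMeasurableSet.of_null ?_)
  exact measure_mono_null (Set.sdiff_subset_sdiff_left (subset_toMeasurable μ _))
    (ae_le_set.1 hae.symm.le)

namespace Problem

variable {n : ℕ} {P : Problem n}

/-- For each fixed `t` the point of the segment depends continuously on the endpoints, and the free
space is closed. -/
theorem isClosed_isFree (P : Problem n) :
    IsClosed {q : State n × State n | P.IsFree q.1 q.2} := by
  have : {q : State n × State n | P.IsFree q.1 q.2} =
      ⋂ t ∈ Set.Icc (0 : ℝ) 1, {q | AffineMap.lineMap q.1 q.2 t ∈ P.free} := by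
    ext q
    simp only [IsFree, segment_eq_image_lineMap, Set.image_subset_iff, Set.mem_ofPred_eq,
      Set.mem_iInter]
    rfl
  rw [this]
  refine isClosed_biInter fun t _ => IsClosed.preimage ?_ isClosed_closure
  simp only [AffineMap.lineMap_apply_module]
  fun_prop

theorem measurableSet_chains (hgoal : MeasurableSet P.goal) (m : ℕ) (c : ℝ≥0∞) :
    MeasurableSet (P.chains m c) := by
  have hev : ∀ i, Measurable fun p : ℕ → State n => p i := fun i => measurable_pi_apply i
  have e : P.chains m c = {p | p 0 = P.start} ∩
      ((⋂ i, ⋂ (_ : i < m), (fun p : ℕ → State n => (p i, p (i + 1))) ⁻¹'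
        {q | P.IsFree q.1 q.2}) ∩ ({p | p m ∈ P.goal} ∩
      {p | ENNReal.ofReal (∑ i ∈ Finset.range m, ‖p i - p (i + 1)‖) < c})) := by
    ext; simp [chains]
  rw [e]
  refine MeasurableSet.inter (measurableSet_eq_fun (hev 0) measurable_const)
    (MeasurableSet.inter ?_ (MeasurableSet.inter (hev m hgoal) ?_))
  · exact MeasurableSet.iInter fun i => MeasurableSet.iInter fun _ =>
      ((hev i).prodMk (hev (i + 1))) P.isClosed_isFree.measurableSet
  · refine measurableSet_lt (ENNReal.measurable_ofReal.comp ?_) measurable_const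
    exact Finset.measurable_sum _ fun i _ => ((hev i).sub (hev (i + 1))).norm

/-- Evaluation at one index maps a Borel set of sequences to an analytic set, which need not be
Borel. -/
theorem nullMeasurableSet_chainSet (hgoal : MeasurableSet P.goal) (μ : Measure (State n))
    [IsFiniteMeasure μ] (c : ℝ≥0∞) : NullMeasurableSet (P.chainSet c) μ :=
  NullMeasurableSet.iUnion fun _ => NullMeasurableSet.iUnion fun _ =>
    nullMeasurableSet_of_analyticSet μ
      ((measurableSet_chains hgoal _ c).analyticSet_image (measurable_pi_apply _))

end Problem

end RRTStar

/-! ### Measurability of the algorithm -/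

namespace RRTStar

section Countable

variable {α β γ ι : Type*} [MeasurableSpace α] [MeasurableSpace β] [MeasurableSpace γ]

/-- Vertex numbers and lists of vertices range over countable types, so they may be frozen when
measurability is checked. -/
theorem measurable_countable_comp [Countable ι] [MeasurableSpace ι] [MeasurableSingletonClass ι]
    {H : ι → α → γ} (hH : ∀ i, Measurable (H i)) {g : α → ι} (hg : Measurable g) :
    Measurable fun a => H (g a) a :=
  (measurable_from_prod_countable_left (f := fun q : α × ι => H q.2 q.1) hH).comp
    (measurable_id.prodMk hg)

theorem measurable_foldl {f : α → β → ι → β}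
    (hf : ∀ j, ∀ g : α → β, Measurable g → Measurable fun a => f a (g a) j) (l : List ι)
    {b : α → β} (hb : Measurable b) : Measurable fun a => l.foldl (f a) (b a) := by
  induction l generalizing b with
  | nil => exact hb
  | cons c l ih => exact ih (hf c b hb)

instance : MeasurableSpace (List ℕ) := ⊤

instance : MeasurableSingletonClass (List ℕ) := ⟨fun _ => trivial⟩

theorem measurable_foldl_comp {f : α → β → ℕ → β}
    (hf : ∀ j, ∀ g : α → β, Measurable g → Measurable fun a => f a (g a) j) {l : α → List ℕ}
    (hl : Measurable l) {b : α → β} (hb : Measurable b) :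
    Measurable fun a => (l a).foldl (f a) (b a) :=
  measurable_countable_comp (H := fun l a => l.foldl (f a) (b a))
    (fun l => measurable_foldl hf l hb) hl

theorem measurable_filter {p : α → ℕ → Bool} (hp : ∀ j, MeasurableSet {a | p a j = true})
    (l : List ℕ) : Measurable fun a => l.filter (p a) := by
  induction l with
  | nil => exact measurable_const
  | cons c l ih =>
    simp only [List.filter_cons]
    exact Measurable.ite (hp c)
      ((measurable_from_top (f := fun l : List ℕ => c :: l)).comp ih) ih

theorem measurable_filter_range {p : α → ℕ → Bool} (hp : ∀ j, MeasurableSet {a | p a j = true})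
    {N : α → ℕ} (hN : Measurable N) : Measurable fun a => (List.range (N a)).filter (p a) :=
  measurable_countable_comp (H := fun N a => (List.range N).filter (p a))
    (fun _ => measurable_filter hp _) hN

theorem measurable_sum_range [AddCommMonoid γ] [MeasurableAdd₂ γ] {f : ℕ → α → γ}
    (hf : ∀ k, Measurable (f k)) {N : α → ℕ} (hN : Measurable N) :
    Measurable fun a => ∑ k ∈ Finset.range (N a), f k a :=
  measurable_countable_comp (H := fun N a => ∑ k ∈ Finset.range N, f k a)
    (fun _ => Finset.measurable_sum _ fun k _ => hf k) hN

end Countable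

theorem measurable_steer {α : Type*} [MeasurableSpace α] {n : ℕ} (η : ℝ≥0∞) {v x : α → State n}
    (hv : Measurable v) (hx : Measurable x) : Measurable fun a => steer η (v a) (x a) := by
  unfold steer
  refine Measurable.ite (measurableSet_le (hx.edist hv) measurable_const) hx ?_
  exact hv.add (((hx.sub hv).norm.const_div _).smul (hx.sub hv))

namespace Tree

variable {n : ℕ}

instance : MeasurableSpace (Tree n) :=
  MeasurableSpace.comap (fun T => (T.num, T.pos, T.parent)) inferInstance

variable {α : Type*} [MeasurableSpace α] {T : α → Tree n} {x : α → State n}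

theorem measurable_of_components (h1 : Measurable fun a => (T a).num)
    (h2 : ∀ i, Measurable fun a => (T a).pos i) (h3 : ∀ i, Measurable fun a => (T a).parent i) :
    Measurable T :=
  measurable_comap_iff.2 (h1.prodMk ((measurable_pi_iff.2 h2).prodMk (measurable_pi_iff.2 h3)))

theorem measurable_components :
    Measurable fun T : Tree n => (T.num, T.pos, T.parent) := comap_measurable _

theorem measurable_num (hT : Measurable T) : Measurable fun a => (T a).num :=
  measurable_components.fst.comp hT

theorem measurable_pos (hT : Measurable T) {j : α → ℕ} (hj : Measurable j) :
    Measurable fun a => (T a).pos (j a) :=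
  measurable_countable_comp (H := fun i a => (T a).pos i)
    (fun i => (measurable_pi_apply i).comp (measurable_components.snd.fst.comp hT)) hj

theorem measurable_parent (hT : Measurable T) {j : α → ℕ} (hj : Measurable j) :
    Measurable fun a => (T a).parent (j a) :=
  measurable_countable_comp (H := fun i a => (T a).parent i)
    (fun i => (measurable_pi_apply i).comp (measurable_components.snd.snd.comp hT)) hj

theorem measurable_iterate (hT : Measurable T) {j : α → ℕ} (hj : Measurable j) (k : ℕ) :
    Measurable fun a => (T a).parent^[k] (j a) := by
  induction k with
  | zero => exact hj
  | succ k ih =>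
    simp only [Function.iterate_succ_apply']
    exact measurable_parent hT ih

theorem measurable_cost (hT : Measurable T) {j : α → ℕ} (hj : Measurable j) :
    Measurable fun a => (T a).cost (j a) :=
  measurable_sum_range (fun k => ((measurable_pos hT (measurable_iterate hT hj k)).sub
    (measurable_pos hT (measurable_iterate hT hj (k + 1)))).norm) (measurable_num hT)

theorem measurableSet_isFree (P : Problem n) {v w : α → State n} (hv : Measurable v)
    (hw : Measurable w) : MeasurableSet {a | P.IsFree (v a) (w a)} :=
  (hv.prodMk hw) P.isClosed_isFree.measurableSet

theorem measurable_bestCost {P : Problem n} (hgoal : MeasurableSet P.goal) (hT : Measurable T) :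
    Measurable fun a => (T a).bestCost P := by
  classical
  unfold bestCost
  refine Measurable.iInf fun j => ?_
  simp only [iInf_eq_if]
  refine Measurable.ite ?_ (ENNReal.measurable_ofReal.comp (measurable_cost hT measurable_const))
    measurable_const
  exact (measurableSet_lt measurable_const (measurable_num hT)).inter
    (measurable_pos hT measurable_const hgoal)

theorem measurable_nearestVertex (hT : Measurable T) (hx : Measurable x) :
    Measurable fun a => (T a).nearestVertex (x a) := by
  unfold nearestVertex
  refine measurable_foldl_comp (fun j g hg => ?_)
    ((measurable_of_countable List.range).comp (measurable_num hT)) measurable_const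
  exact Measurable.ite (measurableSet_lt (hx.sub (measurable_pos hT measurable_const)).norm
    (hx.sub (measurable_pos hT hg)).norm) measurable_const hg

theorem measurable_nearVertices (C : Config) (hT : Measurable T) (hx : Measurable x) :
    Measurable fun a => (T a).nearVertices C (x a) := by
  have hpos : ∀ j, Measurable fun a => (T a).pos j := fun j => measurable_pos hT measurable_const
  obtain ⟨η, r | k⟩ := C
  · refine measurable_filter_range (fun j => ?_) (measurable_num hT)
    simp only [decide_eq_true_eq]
    exact measurableSet_le ((hpos j).edist hx) (measurable_const.min
      ((measurable_of_countable fun N => r (N + 1)).comp (measurable_num hT)))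
  · refine measurable_filter_range (fun j => ?_) (measurable_num hT)
    simp only [decide_eq_true_eq]
    refine measurableSet_lt ?_
      ((measurable_of_countable fun N => k (N + 1)).comp (measurable_num hT))
    simp only [Finset.card_filter]
    refine measurable_sum_range (fun l => ?_) (measurable_num hT)
    have hd : ∀ i, Measurable fun a => ‖(T a).pos i - x a‖ := fun i => ((hpos i).sub hx).norm
    exact Measurable.ite ((measurableSet_lt (hd l) (hd j)).union
      ((measurableSet_eq_fun (hd l) (hd j)).inter (MeasurableSet.const _)))
      measurable_const measurable_const

theorem measurable_chooseParent (P : Problem n) (C : Config) (hT : Measurable T)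
    {v : α → ℕ} (hv : Measurable v) (hx : Measurable x) :
    Measurable fun a => (T a).chooseParent P C (v a) (x a) := by
  unfold chooseParent
  refine measurable_foldl_comp (fun j g hg => ?_) (measurable_nearVertices C hT hx) hv
  have hd : ∀ {j : α → ℕ}, Measurable j →
      Measurable fun a => (T a).cost (j a) + ‖(T a).pos (j a) - x a‖ := fun hj =>
    (measurable_cost hT hj).add ((measurable_pos hT hj).sub hx).norm
  exact Measurable.ite ((measurableSet_lt (hd measurable_const) (hd hg)).inter
    (measurableSet_isFree P (measurable_pos hT measurable_const) hx)) measurable_const hg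

theorem measurable_insert (hT : Measurable T) (hx : Measurable x) {p : α → ℕ}
    (hp : Measurable p) : Measurable fun a => (T a).insert (x a) (p a) := by
  have hN := measurable_num hT
  have hi : ∀ i : ℕ, MeasurableSet {a | i = (T a).num} := fun i =>
    measurableSet_eq_fun measurable_const hN
  refine measurable_of_components ((measurable_of_countable Nat.succ).comp hN)
    (fun i => ?_) fun i => ?_
  · simp only [insert, Function.update_apply]
    exact Measurable.ite (hi i) hx (measurable_pos hT measurable_const)
  · simp only [insert, Function.update_apply]
    exact Measurable.ite (hi i) hp (measurable_parent hT measurable_const)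

theorem measurable_rewireOne (P : Problem n) (hT : Measurable T) {i : α → ℕ}
    (hi : Measurable i) (j : ℕ) : Measurable fun a => (T a).rewireOne P (i a) j := by
  unfold rewireOne
  have hj : Measurable fun _ : α => j := measurable_const
  refine Measurable.ite ((measurableSet_lt ((measurable_cost hT hi).add
    ((measurable_pos hT hi).sub (measurable_pos hT hj)).norm) (measurable_cost hT hj)).inter
    (measurableSet_isFree P (measurable_pos hT hi) (measurable_pos hT hj))) ?_ hT
  have hN := measurable_num hT
  refine measurable_of_components hN (fun l => measurable_pos hT measurable_const) fun l => ?_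
  simp only [Function.update_apply]
  exact Measurable.ite (MeasurableSet.const _) hi (measurable_parent hT measurable_const)

theorem measurable_extend (P : Problem n) (C : Config) (hT : Measurable T) {v : α → ℕ}
    (hv : Measurable v) (hx : Measurable x) :
    Measurable fun a => (T a).extend P C (v a) (x a) := by
  unfold extend
  exact measurable_foldl_comp
    (fun j g hg => measurable_rewireOne P hg (measurable_num hT) j)
    (measurable_nearVertices C hT hx)
    (measurable_insert hT hx (measurable_chooseParent P C hT hv hx))

theorem measurable_step (P : Problem n) (C : Config) (hT : Measurable T) (hx : Measurable x) :
    Measurable fun a => (T a).step P C (x a) := by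
  unfold step
  have hv := measurable_nearestVertex hT hx
  have hvp := measurable_pos hT hv
  have hy := measurable_steer C.maxEdge hvp hx
  refine Measurable.ite ((measurableSet_isFree P hvp hy).inter ?_)
    (measurable_extend P C hT hv hy) hT
  have : {a | ∀ j < (T a).num, (T a).pos j ≠
      steer C.maxEdge ((T a).pos ((T a).nearestVertex (x a))) (x a)} =
      ⋂ j, ({a | j < (T a).num}ᶜ ∪ {a | (T a).pos j =
        steer C.maxEdge ((T a).pos ((T a).nearestVertex (x a))) (x a)}ᶜ) := by
    ext a
    simp [imp_iff_not_or]
  change MeasurableSet {a | ∀ j < (T a).num, _}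
  rw [this]
  exact MeasurableSet.iInter fun j =>
    (measurableSet_lt measurable_const (measurable_num hT)).compl.union
      (measurableSet_eq_fun (measurable_pos hT measurable_const) hy).compl

end Tree

end RRTStar

/-! ### Packing of shortened steps and averaging over fresh samples -/

namespace RRTStar

variable {n : ℕ} {P : Problem n} {C : Config} {T₀ : Tree n}

/-- A shortened step ends on the segment from `v` to `x`, at distance exactly `η` from `v`. -/
theorem norm_sub_steer {η : ℝ≥0∞} {v x : State n} (h : steer η v x ≠ x) :
    η ≠ ⊤ ∧ ‖x - steer η v x‖ + η.toReal = ‖x - v‖ := by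
  unfold steer at h ⊢
  split_ifs at h ⊢ with hle
  · exact absurd rfl h
  push Not at hle
  have htop : η ≠ ⊤ := ne_top_of_lt hle
  refine ⟨htop, ?_⟩
  have hlt : η.toReal < ‖x - v‖ := by
    rw [edist_dist, ENNReal.lt_ofReal_iff_toReal_lt htop, dist_eq_norm] at hle
    exact hle
  have hpos : 0 < ‖x - v‖ := ENNReal.toReal_nonneg.trans_lt hlt
  have e : x - (v + (η.toReal / ‖x - v‖) • (x - v)) = (1 - η.toReal / ‖x - v‖) • (x - v) := by
    rw [sub_smul, one_smul]; abel
  have h1 : η.toReal / ‖x - v‖ ≤ 1 := (div_le_one hpos).2 hlt.le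
  rw [e, norm_smul, Real.norm_of_nonneg (by linarith)]
  field_simp
  ring

/-- The samples that improve the solution of a tree and are shortened by the steering. -/
def steeredImprovements (P : Problem n) (C : Config) : Set (Tree n × State n) :=
  {q | (q.1.step P C q.2).bestCost P < q.1.bestCost P ∧
    steer C.maxEdge (q.1.pos (q.1.nearestVertex q.2)) q.2 ≠ q.2}

theorem measurableSet_steeredImprovements (hgoal : MeasurableSet P.goal) :
    MeasurableSet (steeredImprovements P C) := by
  have hv := Tree.measurable_nearestVertex (n := n) measurable_fst measurable_snd
  exact (measurableSet_lt
    (Tree.measurable_bestCost hgoal (Tree.measurable_step P C measurable_fst measurable_snd))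
    (Tree.measurable_bestCost hgoal measurable_fst)).inter
    (measurableSet_eq_fun (measurable_steer _ (Tree.measurable_pos measurable_fst hv)
      measurable_snd) measurable_snd).compl

/-- New vertices obtained by shortening are far from all others, so there is a bounded potential
that each of them decreases. -/
theorem exists_packing_potential (hb : Bornology.IsBounded P.stateSpace) (hη : 0 < C.maxEdge) :
    ∃ Ψ : Tree n → ℝ≥0∞, (∀ T, Ψ T ≠ ⊤) ∧ ∀ T, T.IsValid P → ∀ y,
      (steeredImprovements P C).indicator 1 (T, y) + Ψ (T.step P C y) ≤ Ψ T := by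
  classical
  -- The minimum with `1` gives a positive real radius even for `η = ∞`, where no step is shortened.
  set ε : ℝ := (min C.maxEdge 1).toReal with hε
  have hmin : min C.maxEdge 1 ≠ ⊤ := ne_top_of_le_ne_top ENNReal.one_ne_top (min_le_right _ _)
  have hεpos : 0 < ε := ENNReal.toReal_pos (lt_min hη one_pos).ne' hmin
  have hfree : TotallyBounded P.free :=
    (Metric.isCompact_of_isClosed_isBounded isClosed_closure
      (hb.subset Set.sdiff_subset).closure).totallyBounded
  obtain ⟨t, ht, hcov⟩ := Metric.totallyBounded_iff.1 hfree (ε / 2) (by linarith)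
  -- The potential counts the balls of a finite cover that contain no vertex yet.
  let A : Tree n → Finset (State n) := fun T =>
    ht.toFinset.filter fun c => ∀ j < T.num, T.pos j ∉ Metric.ball c (ε / 2)
  refine ⟨fun T => (A T).card, fun T => ENNReal.natCast_ne_top _, fun T hT y => ?_⟩
  rcases hT.step_cases C y with e | ⟨-, e⟩
  · have : (T, y) ∉ steeredImprovements P C := fun h => by
      have := h.1
      rw [e] at this
      exact lt_irrefl _ this
    rw [Set.indicator_of_notMem this, e, zero_add]
  · have hsub : A (T.step P C y) ⊆ A T := by
      intro c hc
      simp only [A, Finset.mem_filter] at hc ⊢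
      exact ⟨hc.1, fun j hj => by
        rw [← e.pos_eq j hj]; exact hc.2 j (by rw [e.num_eq]; omega)⟩
    by_cases hB : (T, y) ∈ steeredImprovements P C
    · rw [Set.indicator_of_mem hB, Pi.one_apply]
      obtain ⟨htop, hnorm⟩ := norm_sub_steer hB.2
      simp only at htop hnorm
      set z := steer C.maxEdge (T.pos (T.nearestVertex y)) y with hz
      have hzpos := e.pos_new
      have hzfree := e.valid.pos_free T.num (by rw [e.num_eq]; omega)
      rw [hzpos] at hzfree
      obtain ⟨c, hct, hzc⟩ := Set.mem_iUnion₂.1 (hcov hzfree)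
      have hεη : ε ≤ C.maxEdge.toReal := ENNReal.toReal_mono htop (min_le_left _ _)
      have hlt : A (T.step P C y) ⊂ A T := by
        refine (Finset.ssubset_iff_of_subset hsub).2 ⟨c, ?_, ?_⟩
        · simp only [A, Finset.mem_filter, Set.Finite.mem_toFinset]
          -- A vertex in the same ball would be at distance less than `ε ≤ η` from `z`, hence closer
          -- to the sample `y` than its nearest vertex, whose distance is `‖y - z‖ + η`.
          refine ⟨hct, fun j hj hjc => ?_⟩
          have h1 := (Tree.nearestVertex_spec hT.num_pos y).2 j hj
          have h2 : ‖y - T.pos j‖ ≤ ‖y - z‖ + ‖z - T.pos j‖ := norm_sub_le_norm_sub_add_norm_sub _ _ _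
          have h3 : dist z (T.pos j) < ε := by
            have := dist_triangle_right z (T.pos j) c
            rw [Metric.mem_ball] at hzc hjc
            linarith
          rw [dist_eq_norm] at h3
          linarith
        · simp only [A, Finset.mem_filter, not_and, not_forall]
          exact fun _ => ⟨T.num, by rw [e.num_eq]; omega, by rw [hzpos]; exact not_not.2 hzc⟩
      have := Finset.card_lt_card hlt
      have h2 : 1 + (A (T.step P C y)).card ≤ (A T).card := by omega
      beta_reduce
      exact_mod_cast h2
    · rw [Set.indicator_of_notMem hB, zero_add]
      beta_reduce
      exact_mod_cast Finset.card_le_card hsub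

theorem measurable_run {α : Type*} [MeasurableSpace α] (P : Problem n) (C : Config) (T₀ : Tree n)
    {x : ℕ → α → State n} (hx : ∀ i, Measurable (x i)) (i : ℕ) :
    Measurable fun a => run P C T₀ (fun k => x k a) i := by
  induction i with
  | zero => exact measurable_const
  | succ i ih => exact Tree.measurable_step P C ih (hx i)

theorem run_congr (P : Problem n) (C : Config) (T₀ : Tree n) {x y : ℕ → State n} {i : ℕ}
    (h : ∀ k < i, x k = y k) : run P C T₀ x i = run P C T₀ y i := by
  induction i with
  | zero => rfl
  | succ i ih =>
    simp only [run]
    rw [ih fun k hk => h k (by omega), h i (by omega)]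

section Sampling

variable {Ω : Type*} [MeasurableSpace Ω] {μ : Measure Ω} {x : ℕ → Ω → State n}

theorem indepFun_run (P : Problem n) (C : Config) (T₀ : Tree n) (hx : ∀ i, Measurable (x i))
    (hind : iIndepFun x μ) (i : ℕ) :
    IndepFun (fun ω => run P C T₀ (fun k => x k ω) i) (x i) μ := by
  -- The tree after `i` steps depends only on the samples before `i`; the later ones may be replaced
  -- by `0`.
  let F : (Finset.range i → State n) → Tree n := fun z =>
    run P C T₀ (fun k => if h : k ∈ Finset.range i then z ⟨k, h⟩ else 0) i
  have hF : Measurable F := by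
    refine measurable_run P C T₀ (x := fun k (z : Finset.range i → State n) =>
      if h : k ∈ Finset.range i then z ⟨k, h⟩ else 0) (fun k => ?_) i
    by_cases h : k ∈ Finset.range i
    · simp only [h, dite_true]; exact measurable_pi_apply _
    · simp only [h, dite_false]; exact measurable_const
  have h := (hind.indepFun_finset (Finset.range i) {i} (by simp) hx).comp hF
    (measurable_pi_apply (⟨i, Finset.mem_singleton_self i⟩ : ({i} : Finset ℕ)))
  convert! h using 1
  funext ω
  refine run_congr P C T₀ fun k hk => ?_
  simp [hk]

variable [IsProbabilityMeasure μ]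

/-- Fresh samples can be integrated out. -/
theorem lintegral_run {U : Measure (State n)} (hx : ∀ i, Measurable (x i))
    (hlaw : ∀ i, μ.map (x i) = U) (hind : iIndepFun x μ) {φ : Tree n × State n → ℝ≥0∞}
    (hφ : Measurable φ) (i : ℕ) :
    ∫⁻ ω, φ (run P C T₀ (fun k => x k ω) i, x i ω) ∂μ =
      ∫⁻ ω, ∫⁻ y, φ (run P C T₀ (fun k => x k ω) i, y) ∂U ∂μ := by
  have hT := measurable_run P C T₀ hx i
  have hU : IsProbabilityMeasure U := hlaw 0 ▸ Measure.isProbabilityMeasure_map (hx 0).aemeasurable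
  have h := (indepFun_iff_map_prod_eq_prod_map_map hT.aemeasurable (hx i).aemeasurable).1
    (indepFun_run P C T₀ hx hind i)
  have : IsProbabilityMeasure (μ.map fun ω => run P C T₀ (fun k => x k ω) i) :=
    Measure.isProbabilityMeasure_map hT.aemeasurable
  rw [← lintegral_map (g := fun ω => (run P C T₀ (fun k => x k ω) i, x i ω)) hφ
    (hT.prodMk (hx i)), h, hlaw, lintegral_prod _ hφ.aemeasurable,
    lintegral_map hφ.lintegral_prod_right' hT]

/-- If the sum of `φ` along each run is bounded by a potential, then its conditional expectations
converge to zero almost surely. -/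
theorem ae_tendsto_lintegral_of_potential {U : Measure (State n)} (hT₀ : T₀.IsValid P)
    (hx : ∀ i, Measurable (x i)) (hlaw : ∀ i, μ.map (x i) = U) (hind : iIndepFun x μ)
    {φ : Tree n × State n → ℝ≥0∞} (hφ : Measurable φ) {Ψ : Tree n → ℝ≥0∞} (hΨ : Ψ T₀ ≠ ⊤)
    (h : ∀ T, T.IsValid P → ∀ y, φ (T, y) + Ψ (T.step P C y) ≤ Ψ T) :
    ∀ᵐ ω ∂μ, Tendsto (fun i => ∫⁻ y, φ (run P C T₀ (fun k => x k ω) i, y) ∂U) atTop (𝓝 0) := by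
  have hU : IsProbabilityMeasure U := hlaw 0 ▸ Measure.isProbabilityMeasure_map (hx 0).aemeasurable
  have hsum : ∀ ω N, ∑ i ∈ Finset.range N, φ (run P C T₀ (fun k => x k ω) i, x i ω) +
      Ψ (run P C T₀ (fun k => x k ω) N) ≤ Ψ T₀ := by
    intro ω N
    induction N with
    | zero => simp [run]
    | succ N ih =>
      rw [Finset.sum_range_succ, add_assoc]
      exact (add_le_add_right (h _ (isValid_run C hT₀ _ N) _) _).trans ih
  have htsum : ∀ ω, ∑' i, φ (run P C T₀ (fun k => x k ω) i, x i ω) ≤ Ψ T₀ := fun ω =>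
    ENNReal.tsum_le_of_sum_range_le fun N => le_self_add.trans (hsum ω N)
  have hm1 : ∀ i, Measurable fun ω => φ (run P C T₀ (fun k => x k ω) i, x i ω) := fun i =>
    hφ.comp ((measurable_run P C T₀ hx i).prodMk (hx i))
  have hm2 : ∀ i, Measurable fun ω => ∫⁻ y, φ (run P C T₀ (fun k => x k ω) i, y) ∂U := fun i =>
    hφ.lintegral_prod_right'.comp (measurable_run P C T₀ hx i)
  -- By Tonelli and `lintegral_run`, the conditional expectations have the same total mean as `φ`
  -- along the run, which is at most `Ψ T₀`. So their series converges almost surely.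
  have hfin : ∫⁻ ω, ∑' i, ∫⁻ y, φ (run P C T₀ (fun k => x k ω) i, y) ∂U ∂μ ≠ ⊤ := by
    rw [lintegral_tsum fun i => (hm2 i).aemeasurable]
    simp only [← lintegral_run hx hlaw hind hφ]
    rw [← lintegral_tsum fun i => (hm1 i).aemeasurable]
    refine ne_top_of_le_ne_top hΨ ((lintegral_mono htsum).trans ?_)
    simp
  filter_upwards [ae_lt_top (Measurable.tsum hm2) hfin] with ω hω
  exact ENNReal.tendsto_atTop_zero_of_tsum_ne_top hω.ne

open Classical in
/-- The relative decrease of the error of a tree caused by a sample, which is `0` if the error is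
not positive and finite. -/
noncomputable def relDecrease (P : Problem n) (C : Config) (q : Tree n × State n) : ℝ≥0∞ :=
  if P.optCost < q.1.bestCost P ∧ q.1.bestCost P < ⊤ then
    (q.1.bestCost P - (q.1.step P C q.2).bestCost P) / (q.1.bestCost P - P.optCost) else 0

theorem measurable_relDecrease (hgoal : MeasurableSet P.goal) :
    Measurable (relDecrease P C) := by
  have h1 : Measurable fun q : Tree n × State n => q.1.bestCost P :=
    Tree.measurable_bestCost hgoal measurable_fst
  have h2 : Measurable fun q : Tree n × State n => (q.1.step P C q.2).bestCost P :=
    Tree.measurable_bestCost hgoal (Tree.measurable_step P C measurable_fst measurable_snd)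
  exact Measurable.ite ((measurableSet_lt measurable_const h1).inter
    (measurableSet_lt h1 measurable_const)) ((h1.sub h2).div (h1.sub measurable_const))
    measurable_const

theorem relDecrease_le_one {T : Tree n} (hT : T.IsValid P) (y : State n) :
    relDecrease P C (T, y) ≤ 1 := by
  unfold relDecrease
  split_ifs
  · refine ENNReal.div_le_of_le_mul ?_
    rw [one_mul]
    exact tsub_le_tsub_left (hT.step C y).optCost_le _
  · exact zero_le

/-- Without improvement the left side is `0`. Otherwise the sample was shortened, or it is itself
the new vertex and lies on a better polygonal solution. -/
theorem relDecrease_le_indicator {T : Tree n} (hT : T.IsValid P) (y : State n) :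
    relDecrease P C (T, y) ≤ (P.chainSet (T.bestCost P)).indicator 1 y +
      (steeredImprovements P C).indicator 1 (T, y) := by
  rcases (hT.bestCost_step_le C y).eq_or_lt with e | hlt
  · simp [relDecrease, e]
  · refine (relDecrease_le_one hT y).trans ?_
    by_cases hs : steer C.maxEdge (T.pos (T.nearestVertex y)) y = y
    · have := hT.steer_mem_chainSet C y hlt
      rw [hs] at this
      rw [Set.indicator_of_mem this]
      exact le_self_add
    · have : (T, y) ∈ steeredImprovements P C := ⟨hlt, hs⟩
      rw [Set.indicator_of_mem this]
      exact le_add_self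

theorem add_relDecrease {a b l : ℝ≥0∞} (hla : l < a) (ha : a < ⊤) (hlb : l ≤ b) (hba : b ≤ a) :
    (b - l) / (a - l) + (a - b) / (a - l) = 1 := by
  rw [← ENNReal.add_div, add_comm, tsub_add_tsub_cancel hba hlb]
  exact ENNReal.div_self (tsub_pos_of_lt hla).ne' (ne_top_of_le_ne_top ha.ne tsub_le_self)

theorem antitone_bestCost_run (hT₀ : T₀.IsValid P) (x : ℕ → State n) :
    Antitone fun i => (run P C T₀ x i).bestCost P :=
  antitone_nat_of_succ_le fun i => (isValid_run C hT₀ x i).bestCost_step_le C (x i)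

/-- The conditional expectation of the relative decrease of the error converges to zero. -/
theorem ae_tendsto_lintegral_relDecrease {U : Measure (State n)} (hU : U ≪ volume)
    (hb : Bornology.IsBounded P.stateSpace) (hgoal : MeasurableSet P.goal)
    (hopt : volume P.optimalStates = 0) (hη : 0 < C.maxEdge) (hT₀ : T₀.IsValid P)
    (hx : ∀ i, Measurable (x i)) (hlaw : ∀ i, μ.map (x i) = U) (hind : iIndepFun x μ) :
    ∀ᵐ ω ∂μ, Tendsto (fun i => ∫⁻ y, relDecrease P C (run P C T₀ (fun k => x k ω) i, y) ∂U)
      atTop (𝓝 0) := by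
  have hUp : IsProbabilityMeasure U :=
    hlaw 0 ▸ Measure.isProbabilityMeasure_map (hx 0).aemeasurable
  obtain ⟨Ψ, hΨ, hΨs⟩ := exists_packing_potential (C := C) hb hη
  have hBm : Measurable ((steeredImprovements P C).indicator (1 : Tree n × State n → ℝ≥0∞)) :=
    measurable_one.indicator (measurableSet_steeredImprovements hgoal)
  have h1 := ae_tendsto_lintegral_of_potential hT₀ hx hlaw hind hBm (hΨ T₀) hΨs
  have hMm : ∀ M : ℕ, Measurable fun q : Tree n × State n =>
      min (q.1.bestCost P) M - min ((q.1.step P C q.2).bestCost P) M := fun M =>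
    ((Tree.measurable_bestCost hgoal measurable_fst).min measurable_const).sub
      ((Tree.measurable_bestCost hgoal
        (Tree.measurable_step P C measurable_fst measurable_snd)).min measurable_const)
  -- The best cost is infinite before the first solution, so it serves as a potential only after
  -- truncation. All integers `M` share one null set because the level needed depends on the run.
  have h2 := ae_all_iff.2 fun M : ℕ => ae_tendsto_lintegral_of_potential hT₀ hx hlaw hind (hMm M)
    (C := C) (Ψ := fun T => min (T.bestCost P) M)
    (ne_top_of_le_ne_top (ENNReal.natCast_ne_top M) (min_le_right _ _))
    fun T hT y => (tsub_add_cancel_of_le (min_le_min_right _ (hT.bestCost_step_le C y))).le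
  filter_upwards [h1, h2] with ω h1 h2
  set T : ℕ → Tree n := fun i => run P C T₀ (fun k => x k ω) i with hTdef
  have hTv : ∀ i, (T i).IsValid P := isValid_run C hT₀ _
  have hanti : Antitone fun i => (T i).bestCost P := antitone_bestCost_run hT₀ _
  change Tendsto (fun i => ∫⁻ y, relDecrease P C (T i, y) ∂U) atTop (𝓝 0)
  by_cases hl : ∀ i, P.optCost < (T i).bestCost P
  swap
  · push Not at hl
    obtain ⟨i, hi⟩ := hl
    refine tendsto_const_nhds.congr' ?_
    filter_upwards [eventually_ge_atTop i] with j hj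
    have : ¬ P.optCost < (T j).bestCost P := not_lt.2 ((hanti hj).trans hi)
    simp [relDecrease, this]
  by_cases htop : ∀ i, (T i).bestCost P = ⊤
  · simp [relDecrease, htop]
  push Not at htop
  obtain ⟨i₀, hi₀⟩ := htop
  have hlim := tendsto_atTop_iInf hanti
  set L := ⨅ i, (T i).bestCost P with hL
  have hlL : P.optCost ≤ L := le_iInf fun i => (hl i).le
  rcases hlL.eq_or_lt with e | hlt
  -- Case `L = c*`: the probability of an improvement tends to `0`.
  · have hS : Tendsto (fun i => U (P.chainSet ((T i).bestCost P))) atTop (𝓝 0) := by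
      have h := tendsto_measure_iInter_atTop (μ := U)
        (s := fun i => P.chainSet ((T i).bestCost P))
        (fun i => Problem.nullMeasurableSet_chainSet hgoal U _)
        (fun i j hij => Problem.chainSet_mono (hanti hij)) ⟨0, measure_ne_top _ _⟩
      have h0 : U (⋂ i, P.chainSet ((T i).bestCost P)) = 0 := by
        refine hU (measure_mono_null (fun y hy => ?_) hopt)
        exact Problem.mem_optimalStates_of_tendsto (e ▸ hlim) (Set.mem_iInter.1 hy)
      rwa [h0] at h
    have hS1 := hS.add h1
    rw [add_zero] at hS1
    refine tendsto_of_tendsto_of_tendsto_of_le_of_le tendsto_const_nhds hS1 (fun _ => zero_le)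
      fun i => ?_
    calc ∫⁻ y, relDecrease P C (T i, y) ∂U
        ≤ ∫⁻ y, (P.chainSet ((T i).bestCost P)).indicator 1 y +
            (steeredImprovements P C).indicator 1 (T i, y) ∂U :=
          lintegral_mono fun y => relDecrease_le_indicator (hTv i) y
      _ = ∫⁻ y, (P.chainSet ((T i).bestCost P)).indicator 1 y ∂U +
            ∫⁻ y, (steeredImprovements P C).indicator 1 (T i, y) ∂U :=
          lintegral_add_right _ (hBm.comp measurable_prodMk_left)
      _ ≤ _ := add_le_add_left (by
          refine (lintegral_indicator_le _ _).trans ?_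
          simp) _
  -- Case `L > c*`: from `i₀` on the truncation is inactive, and the denominators are at least `L -
  -- c*`.
  · obtain ⟨M, hM⟩ := ENNReal.exists_nat_gt hi₀
    have h3 := ENNReal.Tendsto.mul_const (b := (L - P.optCost)⁻¹) (h2 M)
      (Or.inr (ENNReal.inv_ne_top.2 (tsub_pos_of_lt hlt).ne'))
    rw [zero_mul] at h3
    refine tendsto_of_tendsto_of_tendsto_of_le_of_le' tendsto_const_nhds h3
      (Eventually.of_forall fun _ => zero_le) ?_
    filter_upwards [eventually_ge_atTop i₀] with i hi
    have hiM : (T i).bestCost P ≤ M := (hanti hi).trans hM.le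
    have hm : Measurable fun y => min ((T i).bestCost P) M -
        min (((T i).step P C y).bestCost P) M :=
      measurable_const.sub ((Tree.measurable_bestCost hgoal
        (Tree.measurable_step P C measurable_const measurable_id)).min measurable_const)
    change _ ≤ (∫⁻ y, min ((T i).bestCost P) M -
        min (((T i).step P C y).bestCost P) M ∂U) * (L - P.optCost)⁻¹
    rw [← lintegral_mul_const _ hm]
    refine lintegral_mono fun y => ?_
    simp only
    rw [min_eq_left hiM, min_eq_left (((hTv i).bestCost_step_le C y).trans hiM)]
    unfold relDecrease
    split_ifs
    · rw [div_eq_mul_inv]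
      gcongr
      exact iInf_le _ i
    · exact zero_le

theorem tendsto_lintegral_relDecrease {U : Measure (State n)} (hU : U ≪ volume)
    (hb : Bornology.IsBounded P.stateSpace) (hgoal : MeasurableSet P.goal)
    (hopt : volume P.optimalStates = 0) (hη : 0 < C.maxEdge) (hT₀ : T₀.IsValid P)
    (hx : ∀ i, Measurable (x i)) (hlaw : ∀ i, μ.map (x i) = U) (hind : iIndepFun x μ) :
    Tendsto (fun i => ∫⁻ ω, relDecrease P C (run P C T₀ (fun k => x k ω) i, x i ω) ∂μ)
      atTop (𝓝 0) := by
  have hUp : IsProbabilityMeasure U :=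
    hlaw 0 ▸ Measure.isProbabilityMeasure_map (hx 0).aemeasurable
  simp only [lintegral_run hx hlaw hind (measurable_relDecrease (C := C) hgoal)]
  rw [← lintegral_zero (μ := μ)]
  refine tendsto_lintegral_of_dominated_convergence (fun _ => 1) (fun i =>
    (measurable_relDecrease hgoal).lintegral_prod_right'.comp (measurable_run P C T₀ hx i))
    (fun i => Eventually.of_forall fun ω => ?_) (by simp)
    (ae_tendsto_lintegral_relDecrease hU hb hgoal hopt hη hT₀ hx hlaw hind)
  refine (lintegral_mono fun y => relDecrease_le_one (isValid_run C hT₀ _ i) y).trans ?_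
  simp

end Sampling

end RRTStar

/-! ### The three forms of sublinear convergence -/

theorem theorem4 {n : ℕ} (P : RRTStar.Problem n)
    (hX : MeasurableSet P.stateSpace) (hXb : Bornology.IsBounded P.stateSpace)
    (hX0 : volume P.stateSpace ≠ 0) (hgoal : MeasurableSet P.goal)
    (hopt : volume P.optimalStates = 0 ∨
      (2 ≤ n ∧ ∃ xg, P.goal = {xg} ∧ P.IsFree P.start xg))
    (C : RRTStar.Config) (hη : 0 < C.maxEdge)
    (T₀ : RRTStar.Tree n) (hT₀ : T₀.IsValid P)
    {Ω : Type*} [MeasurableSpace Ω] (μ : Measure Ω) [IsProbabilityMeasure μ]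
    (x : ℕ → Ω → RRTStar.State n) (hx : ∀ i, Measurable (x i))
    (hlaw : ∀ i, μ.map (x i) = P.uniform) (hind : iIndepFun x μ)
    (c : Ω → ℕ → ℝ≥0∞) (hc : ∀ ω i, c ω i = RRTStar.solutionCost P C T₀ (fun k => x k ω) i)
    (G : Set Ω) (hG : G = {ω | RRTStar.HasErrorRatios (c ω) P.optCost}) :
    (μ G ≠ 0 →
      Tendsto (fun i => ∫⁻ ω, RRTStar.errorRatio (c ω) P.optCost i ∂μ[|G]) atTop (𝓝 1)) ∧
    (∀ᵐ ω ∂μ, ω ∈ G →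
      Tendsto (fun i =>
        ((∫⁻ y, ((RRTStar.run P C T₀ (fun k => x k ω) i).step P C y).bestCost P ∂P.uniform)
          - P.optCost) / (c ω i - P.optCost)) atTop (𝓝 1)) ∧
    (∀ᵐ ω ∂μ, ω ∈ G → ∀ ρ : ℝ≥0∞,
      Tendsto (RRTStar.errorRatio (c ω) P.optCost) atTop (𝓝 ρ) → ρ = 1) := by
  have hopt' : volume P.optimalStates = 0 := by
    rcases hopt with h | ⟨hn, xg, hg, hfree⟩
    · exact h
    · exact RRTStar.Problem.volume_optimalStates_of_isFree hn hg hfree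
  have hU : P.uniform ≪ volume := cond_absolutelyContinuous
  have hUp : IsProbabilityMeasure P.uniform :=
    hlaw 0 ▸ Measure.isProbabilityMeasure_map (hx 0).aemeasurable
  have hd := RRTStar.ae_tendsto_lintegral_relDecrease hU hXb hgoal hopt' hη hT₀ hx hlaw hind
  have he := RRTStar.tendsto_lintegral_relDecrease hU hXb hgoal hopt' hη hT₀ hx hlaw hind
  obtain ⟨T, hT⟩ : ∃ T : Ω → ℕ → RRTStar.Tree n,
      ∀ ω i, RRTStar.run P C T₀ (fun k => x k ω) i = T ω i := ⟨_, fun _ _ => rfl⟩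
  have hcT : ∀ ω i, c ω i = (T ω i).bestCost P := fun ω i => by rw [hc, ← hT]; rfl
  have hTv : ∀ ω i, (T ω i).IsValid P := fun ω i => by
    rw [← hT]; exact RRTStar.isValid_run C hT₀ _ i
  have hTs : ∀ ω i, T ω (i + 1) = (T ω i).step P C (x i ω) := fun ω i => by
    rw [← hT, ← hT]; rfl
  have hTm : ∀ i, Measurable fun ω => T ω i := fun i => by
    simp only [← hT]; exact RRTStar.measurable_run P C T₀ hx i
  have hanti : ∀ ω, Antitone (c ω) := fun ω i j hij => by
    rw [hc, hc]; exact RRTStar.antitone_bestCost_run hT₀ _ hij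
  have hcm : ∀ i, Measurable fun ω => c ω i := fun i => by
    simp only [hcT]; exact RRTStar.Tree.measurable_bestCost hgoal (hTm i)
  simp only [hT] at hd he ⊢
  obtain ⟨δ, hδ⟩ : ∃ δ : ℕ → Ω → ℝ≥0∞,
      ∀ i ω, RRTStar.relDecrease P C (T ω i, x i ω) = δ i ω := ⟨_, fun _ _ => rfl⟩
  have hδm : ∀ i, Measurable (δ i) := fun i => by
    have : δ i = fun ω => RRTStar.relDecrease P C (T ω i, x i ω) := funext fun ω => (hδ i ω).symm
    rw [this]
    exact (RRTStar.measurable_relDecrease hgoal).comp ((hTm i).prodMk (hx i))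
  simp only [hδ] at he
  have hl : ∀ ω i, P.optCost ≤ c ω i := fun ω i => by rw [hcT]; exact (hTv ω i).optCost_le
  have hratio : ∀ ω i, P.optCost < c ω i → c ω i < ⊤ →
      RRTStar.errorRatio (c ω) P.optCost i + δ i ω = 1 := by
    intro ω i h1 h2
    have := RRTStar.add_relDecrease h1 h2 (hl ω (i + 1)) (hanti ω (Nat.le_succ i))
    rw [← hδ, RRTStar.relDecrease, if_pos ⟨hcT ω i ▸ h1, hcT ω i ▸ h2⟩, ← hcT, ← hTs, ← hcT]
    exact this
  have hratio_le : ∀ ω i, RRTStar.errorRatio (c ω) P.optCost i ≤ 1 := fun ω i =>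
    ENNReal.div_le_of_le_mul (by
      rw [one_mul]; exact tsub_le_tsub_right (hanti ω (Nat.le_succ i)) _)
  have hGmem : ∀ ω ∈ G, (∃ i, c ω i < ⊤) ∧ ∀ i, P.optCost < c ω i := fun ω hω => by
    rw [hG] at hω; exact hω
  have hfin : ∀ ω ∈ G, ∀ᶠ i in atTop, c ω i < ⊤ := fun ω hω => by
    obtain ⟨i, hi⟩ := (hGmem ω hω).1
    filter_upwards [eventually_ge_atTop i] with j hj
    exact (hanti ω hj).trans_lt hi
  have hGm : MeasurableSet G := by
    have : G = (⋃ i, {ω | c ω i < ⊤}) ∩ ⋂ i, {ω | P.optCost < c ω i} := by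
      rw [hG]; ext ω; simp [RRTStar.HasErrorRatios]
    rw [this]
    exact (MeasurableSet.iUnion fun i => measurableSet_lt (hcm i) measurable_const).inter
      (MeasurableSet.iInter fun i => measurableSet_lt measurable_const (hcm i))
  refine ⟨fun hG0 => ?_, ?_, ?_⟩
  · have := cond_isProbabilityMeasure hG0
    have hGae : ∀ᵐ ω ∂μ[|G], ω ∈ G := ae_cond_mem hGm
    -- Conditioning on `G` enlarges means of nonnegative functions at most by the factor `1 / μ G`.
    have h1 : Tendsto (fun i => ∫⁻ ω, δ i ω ∂μ[|G]) atTop (𝓝 0) := by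
      have h := ENNReal.Tendsto.const_mul (a := (μ G)⁻¹) he (Or.inr (ENNReal.inv_ne_top.2 hG0))
      rw [mul_zero] at h
      refine tendsto_of_tendsto_of_tendsto_of_le_of_le tendsto_const_nhds h (fun _ => zero_le)
        fun i => ?_
      rw [ProbabilityTheory.cond, lintegral_smul_measure, smul_eq_mul]
      gcongr
      exact Measure.restrict_le_self
    -- While no solution exists, the ratio is not `1 - δ_i`; on `G` the probability of this tends to
    -- `0`, and the ratio is simply bounded below by `0` there.
    have h2 : Tendsto (fun i => μ[|G] {ω | c ω i = ⊤}) atTop (𝓝 0) := by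
      have h := tendsto_measure_iInter_atTop (μ := μ[|G]) (s := fun i => {ω | c ω i = ⊤})
        (fun i => (measurableSet_eq_fun (hcm i) measurable_const).nullMeasurableSet)
        (fun i j hij ω (hω : c ω j = ⊤) => top_le_iff.1 (hω ▸ hanti ω hij))
        ⟨0, measure_ne_top _ _⟩
      have h0 : μ[|G] (⋂ i, {ω | c ω i = ⊤}) = 0 := by
        refine measure_mono_null (fun ω hω => ?_) (ae_iff.1 hGae)
        intro hωG
        obtain ⟨i, hi⟩ := (hGmem ω hωG).1
        exact hi.ne (Set.mem_iInter.1 hω i)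
      rwa [h0] at h
    have h3 := ENNReal.Tendsto.sub (tendsto_const_nhds (x := (1 : ℝ≥0∞))) (h1.add h2)
      (Or.inl ENNReal.one_ne_top)
    rw [add_zero, tsub_zero] at h3
    refine tendsto_of_tendsto_of_tendsto_of_le_of_le h3 tendsto_const_nhds (fun i => ?_)
      fun i => ?_
    · refine tsub_le_iff_right.2 ?_
      have hm : Measurable ({ω | c ω i = ⊤}.indicator (1 : Ω → ℝ≥0∞)) :=
        measurable_one.indicator (measurableSet_eq_fun (hcm i) measurable_const)
      have hm' : Measurable fun ω => δ i ω + {ω | c ω i = ⊤}.indicator (1 : Ω → ℝ≥0∞) ω :=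
        (hδm i).add hm
      rw [← lintegral_indicator_one (measurableSet_eq_fun (hcm i) measurable_const),
        ← lintegral_add_right _ hm, ← lintegral_add_right _ hm']
      calc (1 : ℝ≥0∞) = ∫⁻ _, 1 ∂μ[|G] := by simp
        _ ≤ _ := lintegral_mono_ae ?_
      filter_upwards [hGae] with ω hω
      by_cases htop : c ω i = ⊤
      · have : ω ∈ {ω | c ω i = ⊤} := htop
        rw [Set.indicator_of_mem this, Pi.one_apply]
        exact le_add_self.trans le_add_self
      · rw [← add_assoc, hratio ω i ((hGmem ω hω).2 i) (lt_top_iff_ne_top.2 htop)]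
        exact le_self_add
    · exact (lintegral_mono fun ω => hratio_le ω i).trans (by simp)
  · filter_upwards [hd] with ω hω hωG
    have h3 := ENNReal.Tendsto.sub (tendsto_const_nhds (x := (1 : ℝ≥0∞))) hω
      (Or.inl ENNReal.one_ne_top)
    rw [tsub_zero] at h3
    refine h3.congr' ?_
    filter_upwards [hfin ω hωG] with i hi
    have hli := (hGmem ω hωG).2 i
    symm
    set I := ∫⁻ y, ((T ω i).step P C y).bestCost P ∂P.uniform with hI
    have hsm : Measurable fun y => ((T ω i).step P C y).bestCost P :=
      RRTStar.Tree.measurable_bestCost hgoal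
        (RRTStar.Tree.measurable_step P C measurable_const measurable_id)
    have hle : ∀ y, ((T ω i).step P C y).bestCost P ≤ c ω i := fun y => by
      rw [hcT]; exact (hTv ω i).bestCost_step_le C y
    have hIl : P.optCost ≤ I := by
      calc P.optCost = ∫⁻ _, P.optCost ∂P.uniform := by simp
        _ ≤ I := lintegral_mono fun y => ((hTv ω i).step C y).optCost_le
    have hIc : I ≤ c ω i := (lintegral_mono hle).trans (by simp)
    -- Given the tree, the denominator is constant, so averaging over the next sample acts on the
    -- numerator alone.
    have hsub : ∫⁻ y, RRTStar.relDecrease P C (T ω i, y) ∂P.uniform =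
        (c ω i - I) / (c ω i - P.optCost) := by
      have h4 : ∀ y, RRTStar.relDecrease P C (T ω i, y) =
          (c ω i - ((T ω i).step P C y).bestCost P) * (c ω i - P.optCost)⁻¹ := fun y => by
        rw [RRTStar.relDecrease, if_pos ⟨hcT ω i ▸ hli, hcT ω i ▸ hi⟩, hcT, div_eq_mul_inv]
      have h5 : Measurable fun y => c ω i - ((T ω i).step P C y).bestCost P :=
        measurable_const.sub hsm
      simp only [h4]
      rw [lintegral_mul_const _ h5, div_eq_mul_inv,
        lintegral_sub hsm (ne_top_of_le_ne_top hi.ne hIc) (Eventually.of_forall hle)]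
      simp [hI]
    refine ENNReal.eq_sub_of_add_eq ?_ ?_
    · rw [hsub]
      exact (ENNReal.div_lt_top (ne_top_of_le_ne_top hi.ne tsub_le_self)
        (tsub_pos_of_lt hli).ne').ne
    · rw [hsub]
      exact RRTStar.add_relDecrease hli hi hIl hIc
  -- Fatou's lemma: the means of `δ_i` tend to `0`, so `liminf δ_i = 0` almost surely. If the ratios
  -- tend to `ρ`, then `δ_i` tends to `1 - ρ`, which must vanish; this is truncated subtraction and
  -- gives only `1 ≤ ρ`.
  · have hF : ∫⁻ ω, liminf (fun i => δ i ω) atTop ∂μ = 0 := by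
      refine le_antisymm ((lintegral_liminf_le hδm).trans ?_) zero_le
      rw [he.liminf_eq]
    filter_upwards [(lintegral_eq_zero_iff (Measurable.liminf hδm)).1 hF] with ω hω hωG ρ hρ
    have h1 : Tendsto (fun i => δ i ω) atTop (𝓝 (1 - ρ)) := by
      refine (ENNReal.Tendsto.sub (tendsto_const_nhds (x := (1 : ℝ≥0∞))) hρ
        (Or.inl ENNReal.one_ne_top)).congr' ?_
      filter_upwards [hfin ω hωG] with i hi
      refine (ENNReal.eq_sub_of_add_eq ?_ ?_).symm
      · exact ne_top_of_le_ne_top ENNReal.one_ne_top (hratio_le ω i)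
      · rw [add_comm]; exact hratio ω i ((hGmem ω hωG).2 i) hi
    rw [h1.liminf_eq, Pi.zero_apply] at hω
    exact le_antisymm (le_of_tendsto' hρ (hratio_le ω)) (tsub_eq_zero_iff_le.1 hω)
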